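/- Let $\Gamma$ be a finite simplicial graph with vertex set $V$, and let each $v\in V$ be labelled by an integer $|v|\ge 2$. Let $G_\Gamma$ be the graph product of the finite cyclic groups $G_v=\langle v\rangle$ of order $|v|$, i.e. the quotient of the free product of the $G_v$ by the relations $[G_v,G_w]=1$ for adjacent $v,w$. Write $lk(v)$ for the set of vertices adjacent to $v$ and $st(v)=lk(v)\cup\{v\}$. Assume that $\Gamma$ has no separating intersection of links (SIL): for no pair of vertices $v,w$ with $d_\Gamma(v,w)\ge 2$ does $\Gamma\smallsetminus(lk(v)\cap lk(w))$ have a connected component containing neither $v$ nor $w$. For a vertex $v$ and a component $C$ of $\Gamma\smallsetminus st(v)$, let $\pi_{v,C}$ be the partial conjugation, the automorphism of $G_\Gamma$ that conjugates all generators in $C$ by $v$ and fixes all other generators. Let $Aut^{pc}(G_\Gamma)\le Aut(G_\Gamma)$ be the subgroup generated by all $\pi_{v,C}$. Let $\Sigma_\Gamma\le Aut(G_\Gamma)$ be the subgroup generated by graph symmetries (automorphisms permuting the generators according to an automorphism of $\Gamma$) and vertex automorphisms (automorphisms of a single vertex group $G_v$, extended by the identity on the other vertex groups). Let $\tilde\Gamma$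 be the graph with one vertex $p_{v,C}$ for each such pair $(v,C)$, in which two distinct vertices $p_{v,C}$, $p_{w,D}$ are joined by an edge unless $d_\Gamma(v,w)\ge2$, $v\in D$ and $w\in C$; label $p_{v,C}$ by $|v|$. Let $X_{\tilde\Gamma}$ be the geometric realization of the poset (under inclusion) of the cosets $gG_T$ with $g\in G_{\tilde\Gamma}$ and $T$ a set of vertices spanning a complete subgraph of $\tilde\Gamma$, where $G_T$ is the subgroup generated by $T$. It carries the piecewise Euclidean cubical metric in which every interval $[gG_{T_1},gG_{T_2}]$, $T_1\subseteq T_2$, is a unit cube of dimension $|T_2\smallsetminus T_1|$. The group $G_{\tilde\Gamma}$ acts on $X_{\tilde\Gamma}$ by left multiplication. Then: 1. $\Sigma_\Gamma$ is finite and normalizes $Aut^{pc}(G_\Gamma)$, and $Aut^{pc}(G_\Gamma)\cap\Sigma_\Gamma=1$, so that the subgroup of $Aut(G_\Gamma)$ generated by the two is the semidirect product $Aut^{pc}(G_\Gamma)\rtimes\Sigma_\Gamma$. 2. There is an isomorphism $\phi:G_{\tilde\Gamma}\to Aut^{pc}(G_\Gamma)$ with $\phi(p_{v,C})=\pi_{v,C}$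 for all $(v,C)$. Through $\phi^{-1}$ the group $Aut^{pc}(G_\Gamma)$ acts on $X_{\tilde\Gamma}$, and this action extends to a geometric (that is, isometric, proper and cocompact) action of $Aut^{pc}(G_\Gamma)\rtimes\Sigma_\Gamma$ on $X_{\tilde\Gamma}$. The extended action can be chosen to be, in addition, faithful, provided that $\Gamma$ has no vertex adjacent to all other vertices, or has exactly one such vertex and its label is $2$ (equivalently, provided that the center of $G_\Gamma$ has order at most $2$). -/

import Mathlib

open scoped Pointwise commutatorElement

noncomputable section

namespace GrProd

/-! ### Graph products -/

/-- The commutators `[a, b]` with `a ∈ G v`, `b ∈ G w` and `v`, `w` adjacent, in the free product. -/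
def relators {V : Type*} (Γ : SimpleGraph V) (G : V → Type*) [∀ v, Group (G v)] :
    Set (Monoid.CoprodI G) :=
  {x | ∃ (v w : V) (a : G v) (b : G w), Γ.Adj v w ∧
    x = ⁅(Monoid.CoprodI.of a : Monoid.CoprodI G), (Monoid.CoprodI.of b : Monoid.CoprodI G)⁆}

/-- The graph product of the groups `G v` over the graph `Γ`: the quotient of the free product
by the relations saying that `G v` and `G w` commute for adjacent `v`, `w`. -/
def GraphProduct {V : Type*} (Γ : SimpleGraph V) (G : V → Type*) [∀ v, Group (G v)] : Type _ :=
  Monoid.CoprodI G ⧸ Subgroup.normalClosure (relators Γ G)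

instance {V : Type*} (Γ : SimpleGraph V) (G : V → Type*) [∀ v, Group (G v)] :
    Group (GraphProduct Γ G) :=
  inferInstanceAs (Group (Monoid.CoprodI G ⧸ Subgroup.normalClosure (relators Γ G)))

/-- The canonical map of a vertex group into the graph product. -/
def of {V : Type*} (Γ : SimpleGraph V) (G : V → Type*) [∀ v, Group (G v)] (v : V) :
    G v →* GraphProduct Γ G :=
  (QuotientGroup.mk' (Subgroup.normalClosure (relators Γ G))).comp Monoid.CoprodI.of

theorem commute_of_of_adj {V : Type*} (Γ : SimpleGraph V) (G : V → Type*) [∀ v, Group (G v)]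
    {v w : V} (h : Γ.Adj v w) (a : G v) (b : G w) : Commute (of Γ G v a) (of Γ G w b) := by
  rw [← commutatorElement_eq_one_iff_commute]
  have : (QuotientGroup.mk' (Subgroup.normalClosure (relators Γ G)))
      ⁅(Monoid.CoprodI.of a : Monoid.CoprodI G), (Monoid.CoprodI.of b : Monoid.CoprodI G)⁆ = 1 := by
    rw [QuotientGroup.mk'_apply, QuotientGroup.eq_one_iff]
    exact Subgroup.subset_normalClosure ⟨v, w, a, b, h, rfl⟩
  rw [map_commutatorElement] at this
  exact this

/-- The universal property of the graph product. -/
def lift {V : Type*} {Γ : SimpleGraph V} {G : V → Type*} [∀ v, Group (G v)] {H : Type*} [Group H]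
    (f : ∀ v, G v →* H)
    (hf : ∀ v w, Γ.Adj v w → ∀ (a : G v) (b : G w), Commute (f v a) (f w b)) :
    GraphProduct Γ G →* H :=
  QuotientGroup.lift (Subgroup.normalClosure (relators Γ G)) (Monoid.CoprodI.lift f) <| by
    apply Subgroup.normalClosure_le_normal
    rintro _ ⟨v, w, a, b, h, rfl⟩
    change Monoid.CoprodI.lift f _ = 1
    rw [map_commutatorElement, Monoid.CoprodI.lift_of, Monoid.CoprodI.lift_of,
      commutatorElement_eq_one_iff_commute]
    exact hf v w h a b

theorem lift_of {V : Type*} {Γ : SimpleGraph V} {G : V → Type*} [∀ v, Group (G v)] {H : Type*}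
    [Group H] (f : ∀ v, G v →* H)
    (hf : ∀ v w, Γ.Adj v w → ∀ (a : G v) (b : G w), Commute (f v a) (f w b)) (v : V) (a : G v) :
    lift f hf (of Γ G v a) = f v a :=
  Monoid.CoprodI.lift_of f a

theorem hom_ext {V : Type*} {Γ : SimpleGraph V} {G : V → Type*} [∀ v, Group (G v)] {H : Type*}
    [Group H] {f g : GraphProduct Γ G →* H}
    (h : ∀ v (a : G v), f (of Γ G v a) = g (of Γ G v a)) : f = g := by
  apply QuotientGroup.monoidHom_ext
  apply Monoid.CoprodI.ext_hom
  intro v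
  ext a
  exact h v a

theorem induction_of {V : Type*} {Γ : SimpleGraph V} {G : V → Type*} [∀ v, Group (G v)]
    {motive : GraphProduct Γ G → Prop} (w : GraphProduct Γ G) (one : motive 1)
    (of : ∀ v (a : G v), motive (of Γ G v a))
    (mul : ∀ u w, motive u → motive w → motive (u * w)) : motive w := by
  obtain ⟨w, rfl⟩ := QuotientGroup.mk'_surjective (Subgroup.normalClosure (relators Γ G)) w
  induction w using Monoid.CoprodI.induction_on with
  | one => exact one
  | of v a => exact of v a
  | mul u w hu hw => exact mul _ _ hu hw

/-- The subgroup `G_T` generated by the vertex groups `G v`, `v ∈ T`. -/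
def subgroupOn {V : Type*} (Γ : SimpleGraph V) (G : V → Type*) [∀ v, Group (G v)] (T : Set V) :
    Subgroup (GraphProduct Γ G) :=
  ⨆ v ∈ T, (of Γ G v).range

/-! ### Partial conjugations and separating intersections of links -/

/-- The vertex set of the star of `v`. -/
def star {V : Type*} (Γ : SimpleGraph V) (v : V) : Set V := insert v (Γ.neighborSet v)

/-- The pairs `(v, C)` with `v` a vertex and `C` a connected component of `Γ ∖ st(v)`;
they index the partial conjugations. -/
abbrev PCIndex {V : Type*} (Γ : SimpleGraph V) : Type _ :=
  Σ v : V, (Γ.induce (star Γ v)ᶜ).ConnectedComponent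

/-- The set of vertices of `Γ` in the component `C` of the pair `p = (v, C)`. -/
def PCIndex.verts {V : Type*} {Γ : SimpleGraph V} (p : PCIndex Γ) : Set V :=
  Subtype.val '' p.2.supp

theorem PCIndex.not_mem_star {V : Type*} {Γ : SimpleGraph V} {p : PCIndex Γ} {u : V}
    (hu : u ∈ p.verts) : u ∉ star Γ p.1 := by
  obtain ⟨u, -, rfl⟩ := hu
  exact u.2

theorem PCIndex.mem_star_of_adj {V : Type*} {Γ : SimpleGraph V} {p : PCIndex Γ} {u w : V}
    (hu : u ∈ p.verts) (hw : w ∉ p.verts) (h : Γ.Adj u w) : Γ.Adj p.1 w := by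
  by_contra hvw
  have huS := PCIndex.not_mem_star hu
  have hwS : w ∉ star Γ p.1 := by
    rintro (rfl | h')
    · exact huS (Or.inr h.symm)
    · exact hvw h'
  obtain ⟨u', hu', rfl⟩ := hu
  refine hw ⟨⟨w, hwS⟩, ?_, rfl⟩
  rw [SimpleGraph.ConnectedComponent.mem_supp_iff] at hu' ⊢
  rw [← hu', SimpleGraph.ConnectedComponent.eq]
  exact (SimpleGraph.Adj.reachable (G := Γ.induce (star Γ p.1)ᶜ) (u := ⟨w, hwS⟩) (v := u') h.symm)

/-- The endomorphism of the graph product that conjugates `G u`, `u ∈ C`, by `a ∈ G v`, and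
fixes `G u` for `u ∉ C`. -/
def partialConjHom {V : Type*} (Γ : SimpleGraph V) (G : V → Type*) [∀ v, Group (G v)]
    (p : PCIndex Γ) (a : G p.1) : GraphProduct Γ G →* GraphProduct Γ G :=
  open Classical in
  lift (fun u => if u ∈ p.verts then (MulAut.conj (of Γ G p.1 a)).toMonoidHom.comp (of Γ G u)
      else of Γ G u) <| by
    have key : ∀ u w, u ∈ p.verts → w ∉ p.verts → Γ.Adj u w → ∀ (x : G u) (y : G w),
        Commute (of Γ G p.1 a * of Γ G u x * (of Γ G p.1 a)⁻¹) (of Γ G w y) := by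
      intro u w hu hw h x y
      have h1 : Commute (of Γ G p.1 a) (of Γ G w y) :=
        commute_of_of_adj Γ G (PCIndex.mem_star_of_adj hu hw h) a y
      exact (h1.mul_left (commute_of_of_adj Γ G h x y)).mul_left h1.inv_left
    intro u w h x y
    by_cases hu : u ∈ p.verts <;> by_cases hw : w ∈ p.verts <;> simp only [hu, hw, if_true, if_false]
    · exact (commute_of_of_adj Γ G h x y).map (MulAut.conj (of Γ G p.1 a)).toMonoidHom
    · exact key u w hu hw h x y
    · exact (key w u hw hu h.symm y x).symm
    · exact commute_of_of_adj Γ G h x y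

theorem partialConjHom_of_mem {V : Type*} {Γ : SimpleGraph V} {G : V → Type*} [∀ v, Group (G v)]
    {p : PCIndex Γ} (a : G p.1) {u : V} (hu : u ∈ p.verts) (x : G u) :
    partialConjHom Γ G p a (of Γ G u x) = of Γ G p.1 a * of Γ G u x * (of Γ G p.1 a)⁻¹ := by
  rw [partialConjHom, lift_of, if_pos hu]; rfl

theorem partialConjHom_of_notMem {V : Type*} {Γ : SimpleGraph V} {G : V → Type*}
    [∀ v, Group (G v)] {p : PCIndex Γ} (a : G p.1) {u : V} (hu : u ∉ p.verts) (x : G u) :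
    partialConjHom Γ G p a (of Γ G u x) = of Γ G u x := by
  rw [partialConjHom, lift_of, if_neg hu]

theorem partialConjHom_inv {V : Type*} {Γ : SimpleGraph V} {G : V → Type*}
    [∀ v, Group (G v)] (p : PCIndex Γ) (a b : G p.1) (hab : a * b = 1) :
    (partialConjHom Γ G p a).comp (partialConjHom Γ G p b) = MonoidHom.id _ := by
  have hp : p.1 ∉ p.verts := fun h => PCIndex.not_mem_star h (Or.inl rfl)
  apply hom_ext
  intro u x
  have h1 : of Γ G p.1 a * of Γ G p.1 b = 1 := by rw [← map_mul, hab, map_one]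
  by_cases hu : u ∈ p.verts
  · rw [MonoidHom.comp_apply, partialConjHom_of_mem b hu, map_mul, map_mul, map_inv,
      partialConjHom_of_mem a hu, partialConjHom_of_notMem a hp, eq_inv_of_mul_eq_one_right h1]
    simp [mul_assoc]
  · rw [MonoidHom.comp_apply, partialConjHom_of_notMem b hu, partialConjHom_of_notMem a hu]; rfl

/-- The partial conjugation of the component `C` of `Γ ∖ st(v)` by the element `a ∈ G v`. -/
def partialConj {V : Type*} (Γ : SimpleGraph V) (G : V → Type*) [∀ v, Group (G v)]
    (p : PCIndex Γ) (a : G p.1) : MulAut (GraphProduct Γ G) :=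
  MonoidHom.toMulEquiv (partialConjHom Γ G p a) (partialConjHom Γ G p a⁻¹)
    (partialConjHom_inv p _ _ (inv_mul_cancel a)) (partialConjHom_inv p _ _ (mul_inv_cancel a))

/-- `Γ` has a separating intersection of links. -/
def HasSIL {V : Type*} (Γ : SimpleGraph V) : Prop :=
  ∃ v w : V, 2 ≤ Γ.edist v w ∧
    ∃ C : (Γ.induce (Γ.neighborSet v ∩ Γ.neighborSet w)ᶜ).ConnectedComponent,
      v ∉ Subtype.val '' C.supp ∧ w ∉ Subtype.val '' C.supp

/-- The graph `Γ̃` on the pairs `(v, C)`: two distinct pairs `(v, C)`, `(w, D)` are joined by an edge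
unless `d(v, w) ≥ 2`, `v ∈ D` and `w ∈ C`. -/
def tildeGraph {V : Type*} (Γ : SimpleGraph V) : SimpleGraph (PCIndex Γ) where
  Adj p q := p ≠ q ∧ ¬ (2 ≤ Γ.edist p.1 q.1 ∧ p.1 ∈ q.verts ∧ q.1 ∈ p.verts)
  symm := ⟨fun _ _ h => ⟨h.1.symm, fun h' => h.2 ⟨SimpleGraph.edist_comm ▸ h'.1, h'.2.2, h'.2.1⟩⟩⟩
  loopless := ⟨fun _ h => h.1 rfl⟩

/-! ### Graph products of cyclic groups -/

/-- The family of vertex groups of a labelled graph: `v` carries the cyclic group of order `n v`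
(written multiplicatively). -/
abbrev Cyc {V : Type*} (n : V → ℕ) (v : V) : Type := Multiplicative (ZMod (n v))

/-- The graph product of the cyclic groups of orders `n v`. -/
abbrev CycProd {V : Type*} (Γ : SimpleGraph V) (n : V → ℕ) : Type _ := GraphProduct Γ (Cyc n)

/-- The generator of the graph product corresponding to the vertex `v`. -/
def gen {V : Type*} (Γ : SimpleGraph V) (n : V → ℕ) (v : V) : CycProd Γ n :=
  of Γ (Cyc n) v (Multiplicative.ofAdd 1)

/-- The partial conjugation `π_{v,C}` by the generator `v`. -/
def piConj {V : Type*} (Γ : SimpleGraph V) (n : V → ℕ) (p : PCIndex Γ) : MulAut (CycProd Γ n) :=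
  partialConj Γ (Cyc n) p (Multiplicative.ofAdd 1)

/-- The group generated by all partial conjugations. -/
def autPC {V : Type*} (Γ : SimpleGraph V) (n : V → ℕ) : Subgroup (MulAut (CycProd Γ n)) :=
  Subgroup.closure (Set.range (piConj Γ n))

/-- `f` permutes the generators according to a symmetry of `Γ`. -/
def IsGraphSymmetry {V : Type*} (Γ : SimpleGraph V) (n : V → ℕ) (f : MulAut (CycProd Γ n)) :
    Prop :=
  ∃ τ : Γ ≃g Γ, ∀ v, f (gen Γ n v) = gen Γ n (τ v)

/-- `f` restricts to an automorphism of one vertex group and is the identity on the others. -/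
def IsVertexAut {V : Type*} (Γ : SimpleGraph V) (n : V → ℕ) (f : MulAut (CycProd Γ n)) : Prop :=
  ∃ (v : V) (α : MulAut (Cyc n v)), (∀ a, f (of Γ (Cyc n) v a) = of Γ (Cyc n) v (α a)) ∧
    ∀ u, u ≠ v → ∀ a, f (of Γ (Cyc n) u a) = of Γ (Cyc n) u a

/-- The group `Σ_Γ` generated by graph symmetries and vertex automorphisms. -/
def sigma {V : Type*} (Γ : SimpleGraph V) (n : V → ℕ) : Subgroup (MulAut (CycProd Γ n)) :=
  Subgroup.closure {f | IsGraphSymmetry Γ n f ∨ IsVertexAut Γ n f}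

/-- The labelling of `Γ̃`: the vertex `p_{v,C}` carries the order of `v`. -/
def tildeOrder {V : Type*} (Γ : SimpleGraph V) (n : V → ℕ) (p : PCIndex Γ) : ℕ := n p.1

/-! ### The cubical complex of a graph product -/

/-- The poset, ordered by inclusion, of the cosets `g G_T` with `T` spanning a complete subgraph. -/
def CliqueCoset {V : Type*} (Γ : SimpleGraph V) (G : V → Type*) [∀ v, Group (G v)] : Type _ :=
  {S : Set (GraphProduct Γ G) // ∃ (g : GraphProduct Γ G) (T : Set V), Γ.IsClique T ∧
    S = g • (subgroupOn Γ G T : Set (GraphProduct Γ G))}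

instance {V : Type*} (Γ : SimpleGraph V) (G : V → Type*) [∀ v, Group (G v)] :
    PartialOrder (CliqueCoset Γ G) :=
  Subtype.partialOrder _

instance {V : Type*} (Γ : SimpleGraph V) (G : V → Type*) [∀ v, Group (G v)] :
    MulAction (GraphProduct Γ G) (CliqueCoset Γ G) where
  smul g S := ⟨g • S.1, by
    obtain ⟨h, T, hT, hS⟩ := S.2
    exact ⟨g * h, T, hT, by rw [hS, mul_smul]⟩⟩
  one_smul S := Subtype.ext (one_smul _ S.1)
  mul_smul g h S := Subtype.ext (mul_smul g h S.1)

/-- The type of a coset `S = g G_T`: the set of `v` with `S · G_v ⊆ S`. If the vertex groups are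
nontrivial, this is `T`. -/
def CliqueCoset.type {V : Type*} {Γ : SimpleGraph V} {G : V → Type*} [∀ v, Group (G v)]
    (S : CliqueCoset Γ G) : Set V :=
  {v | ∀ s ∈ S.1, ∀ a : G v, s * of Γ G v a ∈ S.1}

/-- The complex `X_Γ`: the geometric realization of the poset of cosets. A point is given by its
barycentric coordinates, which are supported on a (finite) chain. -/
@[ext]
structure Complex {V : Type*} (Γ : SimpleGraph V) (G : V → Type*) [∀ v, Group (G v)] where
  weight : CliqueCoset Γ G →₀ ℝ
  nonneg : ∀ S, 0 ≤ weight S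
  sum_eq_one : (weight.sum fun _ r => r) = 1
  chain : IsChain (· ≤ ·) (weight.support : Set (CliqueCoset Γ G))

theorem CliqueCoset.smul_le_smul {V : Type*} {Γ : SimpleGraph V} {G : V → Type*}
    [∀ v, Group (G v)] (g : GraphProduct Γ G) {S S' : CliqueCoset Γ G} (h : S ≤ S') :
    g • S ≤ g • S' :=
  Set.smul_set_mono (a := g) (show S.1 ⊆ S'.1 from h)

/-- The action on the complex induced by left multiplication on the poset of cosets. -/
instance {V : Type*} (Γ : SimpleGraph V) (G : V → Type*) [∀ v, Group (G v)] :
    MulAction (GraphProduct Γ G) (Complex Γ G) where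
  smul g x :=
    { weight := x.weight.equivMapDomain (MulAction.toPerm g)
      nonneg := fun S => x.nonneg _
      sum_eq_one := by
        rw [Finsupp.equivMapDomain_eq_mapDomain, Finsupp.sum_mapDomain_index (fun _ => rfl)
          (fun _ _ _ => rfl)]
        exact x.sum_eq_one
      chain := by
        intro S hS S' hS' hne
        simp only [Finset.mem_coe, Finsupp.mem_support_iff, Finsupp.equivMapDomain_apply] at hS hS'
        have := x.chain (Finsupp.mem_support_iff.2 hS) (Finsupp.mem_support_iff.2 hS')
          (fun h => hne ((MulAction.toPerm g).symm.injective h))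
        refine this.imp (fun h => ?_) (fun h => ?_) <;>
          simpa using CliqueCoset.smul_le_smul g h }
  one_smul x := by
    apply Complex.ext; ext S
    exact congrArg x.weight (show (1 : GraphProduct Γ G)⁻¹ • S = S by rw [inv_one, one_smul])
  mul_smul g h x := by
    apply Complex.ext; ext S
    exact congrArg x.weight (show (g * h)⁻¹ • S = h⁻¹ • g⁻¹ • S by rw [mul_inv_rev, mul_smul])

/-- The coordinates of a point in its cube `[g G_{T₁}, g G_{T₂}]`, which is identified with
`{t ∈ [0,1]^V | t = 1 on T₁, t = 0 outside T₂}`: its vertex `g G_T` is the indicator function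
of `T`, and each simplex is mapped affinely. -/
def Complex.coord {V : Type*} {Γ : SimpleGraph V} {G : V → Type*} [∀ v, Group (G v)]
    (x : Complex Γ G) (v : V) : ℝ :=
  x.weight.sum fun S r => S.type.indicator (fun _ => r) v

/-- `x` and `y` lie in a common cube of the complex, i.e., in the realization of an interval
`[A, B]` of the poset. -/
def Complex.InCommonCube {V : Type*} {Γ : SimpleGraph V} {G : V → Type*} [∀ v, Group (G v)]
    (x y : Complex Γ G) : Prop :=
  ∃ A B : CliqueCoset Γ G, (∀ S ∈ x.weight.support, A ≤ S ∧ S ≤ B) ∧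
    ∀ S ∈ y.weight.support, A ≤ S ∧ S ≤ B

/-- The Euclidean distance of the coordinates of two points (of a common cube), for a finite set
of vertices. -/
def Complex.cubeDist {V : Type*} {Γ : SimpleGraph V} {G : V → Type*} [∀ v, Group (G v)]
    (x y : Complex Γ G) : ℝ :=
  √ (∑ᶠ v, (x.coord v - y.coord v) ^ 2)

/-- There is a string of points from `x` to `y` of total length `L`, consecutive points of which
lie in a common cube. -/
inductive Complex.HasString {V : Type*} {Γ : SimpleGraph V} {G : V → Type*} [∀ v, Group (G v)] :
    Complex Γ G → Complex Γ G → ℝ → Prop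
  | refl (x : Complex Γ G) : Complex.HasString x x 0
  | cons {x y z : Complex Γ G} {L : ℝ} (h : Complex.InCommonCube x y)
      (hs : Complex.HasString y z L) : Complex.HasString x z (Complex.cubeDist x y + L)

/-- The cubical (piecewise Euclidean) metric: the infimum of the lengths of strings. -/
def Complex.cubicalDist {V : Type*} {Γ : SimpleGraph V} {G : V → Type*} [∀ v, Group (G v)]
    (x y : Complex Γ G) : ℝ :=
  sInf {L | Complex.HasString x y L}

/-! ### The cubical distance is a metric -/

section Metric

variable {V : Type*} {Γ : SimpleGraph V} {G : V → Type*} [∀ v, Group (G v)]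

theorem of_mem_subgroupOn {T : Set V} {v : V} (hv : v ∈ T) (a : G v) :
    of Γ G v a ∈ subgroupOn Γ G T :=
  (le_iSup₂ (f := fun v (_ : v ∈ T) => (of Γ G v).range) v hv) ⟨a, rfl⟩

theorem CliqueCoset.nonempty (S : CliqueCoset Γ G) : S.1.Nonempty := by
  obtain ⟨g, T, -, hS⟩ := S.2
  rw [hS]
  exact ⟨g • 1, Set.smul_mem_smul_set (one_mem _)⟩

theorem CliqueCoset.mem_iff {S : CliqueCoset Γ G} {s x : GraphProduct Γ G} (hs : s ∈ S.1) :
    x ∈ S.1 ↔ s⁻¹ * x ∈ subgroupOn Γ G S.type := by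
  obtain ⟨g, T, hT, hS⟩ := S.2
  have key : ∀ s ∈ S.1, ∀ x, x ∈ S.1 ↔ s⁻¹ * x ∈ subgroupOn Γ G T := by
    intro s hs x
    rw [hS, Set.mem_smul_set_iff_inv_smul_mem, smul_eq_mul, SetLike.mem_coe] at hs ⊢
    have : s⁻¹ * x = (g⁻¹ * s)⁻¹ * (g⁻¹ * x) := by group
    rw [this, Subgroup.mul_mem_cancel_left _ (inv_mem hs)]
  have hle : subgroupOn Γ G T = subgroupOn Γ G S.type := by
    apply le_antisymm
    · refine iSup₂_le fun v hv => ?_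
      rintro _ ⟨a, rfl⟩
      refine of_mem_subgroupOn ?_ a
      intro t ht b
      rw [key t ht]
      simpa using of_mem_subgroupOn hv b
    · refine iSup₂_le fun v hv => ?_
      rintro _ ⟨a, rfl⟩
      have := hv s hs a
      rw [key s hs] at this
      simpa using this
  rw [key s hs, hle]

theorem CliqueCoset.mem_type_iff {S : CliqueCoset Γ G} {s : GraphProduct Γ G} (hs : s ∈ S.1)
    {v : V} : v ∈ S.type ↔ ∀ a : G v, s * of Γ G v a ∈ S.1 := by
  refine ⟨fun h => h s hs, fun h t ht a => ?_⟩
  have := h a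
  rw [CliqueCoset.mem_iff hs] at this
  rw [CliqueCoset.mem_iff ht]
  simpa using this

theorem CliqueCoset.type_mono {S S' : CliqueCoset Γ G} (h : S ≤ S') : S.type ⊆ S'.type := by
  intro v hv
  obtain ⟨s, hs⟩ := S.nonempty
  exact (CliqueCoset.mem_type_iff (h hs)).2 fun a => h (hv s hs a)

theorem CliqueCoset.le_of_type {A S S' : CliqueCoset Γ G} (h : A ≤ S) (h' : A ≤ S')
    (ht : S.type ⊆ S'.type) : S ≤ S' := by
  obtain ⟨s, hs⟩ := A.nonempty
  intro x hx
  have hx' := (CliqueCoset.mem_iff (h hs)).1 hx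
  refine (CliqueCoset.mem_iff (h' hs)).2 ?_
  exact (biSup_mono fun _ hv => ht hv : subgroupOn Γ G S.type ≤ _) hx'

namespace Complex

open Classical in
theorem coord_eq (x : Complex Γ G) (v : V) :
    x.coord v = ∑ S ∈ x.weight.support with v ∈ S.type, x.weight S := by
  rw [coord, Finsupp.sum, Finset.sum_filter]
  exact Finset.sum_congr rfl fun S _ => by simp [Set.indicator_apply]

theorem sum_eq (x : Complex Γ G) : ∑ S ∈ x.weight.support, x.weight S = 1 := x.sum_eq_one

open Classical in
/-- The total weight above `S`. -/
def upper (x : Complex Γ G) (S : CliqueCoset Γ G) : ℝ :=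
  ∑ S' ∈ x.weight.support with S ≤ S', x.weight S'

open Classical in
/-- The total weight strictly above `S`. -/
def supper (x : Complex Γ G) (S : CliqueCoset Γ G) : ℝ :=
  ∑ S' ∈ x.weight.support with S < S', x.weight S'

theorem upper_eq (x : Complex Γ G) (S : CliqueCoset Γ G) :
    x.upper S = x.supper S + x.weight S := by
  classical
  have h : x.weight S = ∑ S' ∈ x.weight.support, if S = S' then x.weight S' else 0 := by
    rw [Finset.sum_ite_eq]
    by_cases h : S ∈ x.weight.support
    · rw [if_pos h]
    · rw [if_neg h, Finsupp.notMem_support_iff.1 h]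
  rw [h, upper, supper, Finset.sum_filter, Finset.sum_filter, ← Finset.sum_add_distrib]
  refine Finset.sum_congr rfl fun S' _ => ?_
  rcases eq_or_ne S S' with rfl | hne
  · simp
  · simp [hne, lt_iff_le_and_ne]

theorem upper_le_coord (x : Complex Γ G) {S : CliqueCoset Γ G} {v : V} (hv : v ∈ S.type) :
    x.upper S ≤ x.coord v := by
  classical
  rw [coord_eq, upper]
  refine Finset.sum_le_sum_of_subset_of_nonneg ?_ fun S' _ _ => x.nonneg S'
  intro S' hS'
  rw [Finset.mem_filter] at hS' ⊢
  exact ⟨hS'.1, CliqueCoset.type_mono hS'.2 hv⟩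

theorem coord_le_supper (x : Complex Γ G) {S : CliqueCoset Γ G} (hS : S ∈ x.weight.support) {v : V}
    (hv : v ∉ S.type) : x.coord v ≤ x.supper S := by
  classical
  rw [coord_eq, supper]
  refine Finset.sum_le_sum_of_subset_of_nonneg ?_ fun S' _ _ => x.nonneg S'
  intro S' hS'
  rw [Finset.mem_filter] at hS' ⊢
  refine ⟨hS'.1, ?_⟩
  have hn : ¬ S' ≤ S := fun h => hv (CliqueCoset.type_mono h hS'.2)
  rcases x.chain.total hS hS'.1 with h | h
  · exact lt_of_le_not_ge h hn
  · exact absurd h hn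

theorem exists_upper (y : Complex Γ G) {A S : CliqueCoset Γ G} (hA : A ≤ S)
    (hy : ∀ S' ∈ y.weight.support, A ≤ S') :
    y.upper S = 1 ∨ ∃ v ∈ S.type, y.coord v ≤ y.upper S := by
  classical
  by_cases hP : ∀ S' ∈ y.weight.support, S ≤ S'
  · left
    rw [upper, Finset.filter_true_of_mem hP, sum_eq]
  · right
    push Not at hP
    have hne : (y.weight.support.filter fun S' => ¬ S ≤ S').Nonempty := by
      obtain ⟨S', h, h'⟩ := hP
      exact ⟨S', Finset.mem_filter.2 ⟨h, h'⟩⟩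
    obtain ⟨S₁, hS₁⟩ := Finset.exists_maximal hne
    have hm := Finset.mem_filter.1 hS₁.prop
    have hnt : ¬ S.type ⊆ S₁.type := fun h => hm.2 (CliqueCoset.le_of_type hA (hy _ hm.1) h)
    obtain ⟨v, hv, hv₁⟩ := Set.not_subset.1 hnt
    refine ⟨v, hv, ?_⟩
    rw [coord_eq, upper]
    refine Finset.sum_le_sum_of_subset_of_nonneg ?_ fun S' _ _ => y.nonneg S'
    intro S' hS'
    rw [Finset.mem_filter] at hS' ⊢
    refine ⟨hS'.1, ?_⟩
    by_contra hnot
    have hn : ¬ S' ≤ S₁ := fun h => hv₁ (CliqueCoset.type_mono h hS'.2)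
    rcases y.chain.total hm.1 hS'.1 with h | h
    · exact hn (hS₁.le_of_ge (Finset.mem_filter.2 ⟨hS'.1, hnot⟩) h)
    · exact hn h

theorem exists_supper (y : Complex Γ G) {A S : CliqueCoset Γ G} (hA : A ≤ S)
    (hy : ∀ S' ∈ y.weight.support, A ≤ S') :
    y.supper S = 0 ∨ ∃ v, v ∉ S.type ∧ y.supper S ≤ y.coord v := by
  classical
  rcases (y.weight.support.filter fun S' => S < S').eq_empty_or_nonempty with hQ | hne
  · left
    rw [supper, hQ, Finset.sum_empty]
  · right
    obtain ⟨S₂, hS₂⟩ := Finset.exists_minimal hne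
    have hm := Finset.mem_filter.1 hS₂.prop
    have hnt : ¬ S₂.type ⊆ S.type :=
      fun h => hm.2.not_ge (CliqueCoset.le_of_type (hy _ hm.1) hA h)
    obtain ⟨v, hv₂, hv⟩ := Set.not_subset.1 hnt
    refine ⟨v, hv, le_trans ?_ (y.upper_le_coord hv₂)⟩
    rw [upper, supper]
    refine Finset.sum_le_sum_of_subset_of_nonneg ?_ fun S' _ _ => y.nonneg S'
    intro S' hS'
    have h0 := Finset.mem_filter.1 hS'
    refine Finset.mem_filter.2 ⟨h0.1, ?_⟩
    rcases y.chain.total hm.1 h0.1 with h | h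
    · exact h
    · exact hS₂.le_of_le hS' h

theorem abs_coord_sub_le [Finite V] (x y : Complex Γ G) (v : V) :
    |x.coord v - y.coord v| ≤ cubeDist x y := by
  have := Fintype.ofFinite V
  rw [cubeDist, finsum_eq_sum_of_fintype]
  apply Real.abs_le_sqrt
  exact Finset.single_le_sum (f := fun v => (x.coord v - y.coord v) ^ 2)
    (fun _ _ => sq_nonneg _) (Finset.mem_univ v)

theorem cubeDist_nonneg (x y : Complex Γ G) : 0 ≤ cubeDist x y := Real.sqrt_nonneg _

theorem cubeDist_comm (x y : Complex Γ G) : cubeDist x y = cubeDist y x := by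
  simp only [cubeDist, sub_sq_comm]

theorem InCommonCube.symm {x y : Complex Γ G} (h : InCommonCube x y) : InCommonCube y x := by
  obtain ⟨A, B, h₁, h₂⟩ := h
  exact ⟨A, B, h₂, h₁⟩

theorem InCommonCube.weight_le [Finite V] {x y : Complex Γ G} (h : InCommonCube x y)
    (S : CliqueCoset Γ G) : x.weight S ≤ y.weight S + 2 * cubeDist x y := by
  have hd := cubeDist_nonneg x y
  by_cases hS : S ∈ x.weight.support
  · obtain ⟨A, B, hx, hy⟩ := h
    have hAS := (hx S hS).1
    have hyA : ∀ S' ∈ y.weight.support, A ≤ S' := fun S' hS' => (hy S' hS').1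
    have h1 : x.upper S ≤ y.upper S + cubeDist x y := by
      classical
      rcases y.exists_upper hAS hyA with h | ⟨v, hv, h⟩
      · have : x.upper S ≤ 1 := by
          rw [← x.sum_eq, upper]
          exact Finset.sum_le_sum_of_subset_of_nonneg (Finset.filter_subset _ _)
            fun S' _ _ => x.nonneg S'
        linarith
      · have h2 := abs_le.1 (abs_coord_sub_le x y v)
        have h3 := x.upper_le_coord hv
        linarith [h2.2]
    have h2 : y.supper S ≤ x.supper S + cubeDist x y := by
      rcases y.exists_supper hAS hyA with h | ⟨v, hv, h⟩
      · have : 0 ≤ x.supper S := Finset.sum_nonneg fun S' _ => x.nonneg S'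
        linarith
      · have h2 := abs_le.1 (abs_coord_sub_le x y v)
        have h3 := x.coord_le_supper hS hv
        linarith [h2.1]
    have h3 := x.upper_eq S
    have h4 := y.upper_eq S
    linarith
  · rw [Finsupp.notMem_support_iff.1 hS]
    linarith [y.nonneg S]

theorem HasString.nonneg {x y : Complex Γ G} {L : ℝ} (h : HasString x y L) : 0 ≤ L := by
  induction h with
  | refl => exact le_rfl
  | cons _ _ ih => exact add_nonneg (cubeDist_nonneg _ _) ih

theorem HasString.trans {x y z : Complex Γ G} {L M : ℝ} (h : HasString x y L)
    (h' : HasString y z M) : HasString x z (L + M) := by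
  induction h with
  | refl => simpa using h'
  | cons hc _ ih => rw [add_assoc]; exact .cons hc (ih h')

theorem HasString.single {x y : Complex Γ G} (h : InCommonCube x y) :
    HasString x y (cubeDist x y) := by
  simpa using HasString.cons h (.refl y)

theorem HasString.symm {x y : Complex Γ G} {L : ℝ} (h : HasString x y L) : HasString y x L := by
  induction h with
  | refl => exact .refl _
  | @cons x y z L hc _ ih =>
    rw [add_comm, cubeDist_comm]
    exact ih.trans (.single hc.symm)

theorem HasString.weight_le [Finite V] {x y : Complex Γ G} {L : ℝ} (h : HasString x y L)
    (S : CliqueCoset Γ G) : x.weight S ≤ y.weight S + 2 * L := by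
  induction h with
  | refl => simp
  | cons hc _ ih => linarith [hc.weight_le S]

/-- The vertex of the complex given by the coset `S`. -/
def vertex (S : CliqueCoset Γ G) : Complex Γ G where
  weight := Finsupp.single S 1
  nonneg S' := by
    classical
    rw [Finsupp.single_apply]; split_ifs <;> norm_num
  sum_eq_one := by simp
  chain := by
    rw [Finsupp.support_single _ one_ne_zero, Finset.coe_singleton]
    exact Set.subsingleton_singleton.isChain

/-- The coset `g G_T` of a clique `T`. -/
def _root_.GrProd.CliqueCoset.mk (g : GraphProduct Γ G) (T : Set V) (hT : Γ.IsClique T) :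
    CliqueCoset Γ G :=
  ⟨g • (subgroupOn Γ G T : Set (GraphProduct Γ G)), g, T, hT, rfl⟩

theorem inCommonCube_vertex {S S' : CliqueCoset Γ G} (h : S ≤ S') :
    InCommonCube (vertex S) (vertex S') := by
  have hs : ∀ S : CliqueCoset Γ G, (vertex S).weight.support = {S} := fun S =>
    Finsupp.support_single _ one_ne_zero
  refine ⟨S, S', ?_, ?_⟩ <;> intro S'' hS'' <;> rw [hs, Finset.mem_singleton] at hS'' <;>
    subst hS''
  · exact ⟨le_rfl, h⟩
  · exact ⟨h, le_rfl⟩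

theorem mk_empty_le {g : GraphProduct Γ G} {S : CliqueCoset Γ G} (hg : g ∈ S.1) :
    CliqueCoset.mk g ∅ (by simp) ≤ S := by
  rintro _ ⟨x, hx, rfl⟩
  have : x = 1 := by simpa [subgroupOn] using hx
  subst this
  simpa using hg

theorem exists_string_vertex (x : Complex Γ G) :
    ∃ g, ∃ L, HasString x (vertex (CliqueCoset.mk g ∅ (by simp))) L := by
  have hne : x.weight.support.Nonempty := by
    rw [Finset.nonempty_iff_ne_empty]
    intro h
    have := x.sum_eq
    rw [h, Finset.sum_empty] at this
    exact zero_ne_one this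
  obtain ⟨A, hA⟩ := Finset.exists_minimal hne
  obtain ⟨B, hB⟩ := Finset.exists_maximal hne
  have hcube : InCommonCube x (vertex A) := by
    refine ⟨A, B, fun S hS => ⟨?_, ?_⟩, fun S hS => ?_⟩
    · rcases x.chain.total hA.prop hS with h | h
      · exact h
      · exact hA.le_of_le hS h
    · rcases x.chain.total hS hB.prop with h | h
      · exact h
      · exact hB.le_of_ge hS h
    · rw [show (vertex A).weight.support = {A} from
        Finsupp.support_single _ one_ne_zero, Finset.mem_singleton] at hS
      subst hS
      refine ⟨le_rfl, ?_⟩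
      rcases x.chain.total hA.prop hB.prop with h | h
      · exact h
      · exact hB.le_of_ge hA.prop h
  obtain ⟨g, hg⟩ := A.nonempty
  exact ⟨g, _, (HasString.single hcube).trans
    (.single (inCommonCube_vertex (mk_empty_le hg)).symm)⟩

theorem exists_string_mul (w : GraphProduct Γ G) : ∀ g : GraphProduct Γ G,
    ∃ L, HasString (vertex (CliqueCoset.mk g ∅ (by simp)))
      (vertex (CliqueCoset.mk (g * w) ∅ (by simp))) L := by
  induction w using GrProd.induction_of with
  | one =>
    intro g
    rw [mul_one]
    exact ⟨0, .refl _⟩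
  | of v a =>
    intro g
    have h1 : g ∈ (CliqueCoset.mk (Γ := Γ) (G := G) g {v} (by simp)).1 :=
      ⟨1, one_mem _, mul_one g⟩
    have h2 : g * of Γ G v a ∈ (CliqueCoset.mk (Γ := Γ) (G := G) g {v} (by simp)).1 :=
      ⟨_, of_mem_subgroupOn (Set.mem_singleton v) a, rfl⟩
    exact ⟨_, (HasString.single (inCommonCube_vertex (mk_empty_le h1))).trans
      (.single (inCommonCube_vertex (mk_empty_le h2)).symm)⟩
  | mul u w hu hw =>
    intro g
    obtain ⟨L, hL⟩ := hu g
    obtain ⟨M, hM⟩ := hw (g * u)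
    rw [mul_assoc] at hM
    exact ⟨_, hL.trans hM⟩

theorem exists_string (x y : Complex Γ G) : ∃ L, HasString x y L := by
  obtain ⟨g, L, hL⟩ := exists_string_vertex x
  obtain ⟨h, M, hM⟩ := exists_string_vertex y
  obtain ⟨N, hN⟩ := exists_string_mul (g⁻¹ * h) g
  rw [mul_inv_cancel_left] at hN
  exact ⟨_, (hL.trans hN).trans hM.symm⟩

theorem bddBelow_string (x y : Complex Γ G) : BddBelow {L | HasString x y L} :=
  ⟨0, fun _ h => HasString.nonneg h⟩

/-- For a finite graph, the complex is a metric space with the cubical metric. -/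
instance [Finite V] : MetricSpace (Complex Γ G) where
  dist := cubicalDist
  dist_self x := le_antisymm (csInf_le (bddBelow_string x x) (.refl x))
    (Real.sInf_nonneg fun _ h => HasString.nonneg h)
  dist_comm x y := congrArg sInf (Set.ext fun _ => ⟨HasString.symm, HasString.symm⟩)
  dist_triangle x y z := by
    refine le_of_forall_pos_lt_add fun ε hε => ?_
    obtain ⟨L, hL, hL'⟩ := Real.lt_sInf_add_pos (s := {L | HasString x y L}) (exists_string x y)
      (half_pos hε)
    obtain ⟨M, hM, hM'⟩ := Real.lt_sInf_add_pos (s := {L | HasString y z L}) (exists_string y z)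
      (half_pos hε)
    have h := csInf_le (bddBelow_string x z) (HasString.trans hL hM)
    change sInf _ < sInf _ + sInf _ + ε
    linarith
  eq_of_dist_eq_zero := by
    intro x y h
    have key : ∀ x y : Complex Γ G, cubicalDist x y = 0 → ∀ S, x.weight S ≤ y.weight S := by
      intro x y h S
      refine le_of_forall_pos_lt_add fun ε hε => ?_
      obtain ⟨L, hL, hL'⟩ := Real.lt_sInf_add_pos (s := {L | HasString x y L}) (exists_string x y)
        (half_pos hε)
      have h' : sInf {L | HasString x y L} = 0 := h
      rw [h'] at hL'
      linarith [HasString.weight_le hL S]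
    have h' : cubicalDist y x = 0 := by
      rw [← h]
      exact congrArg sInf (Set.ext fun _ => ⟨HasString.symm, HasString.symm⟩)
    apply Complex.ext
    ext S
    exact le_antisymm (key x y h S) (key y x h' S)

end Complex

end Metric

/-! ### Geometric actions -/

/-- An action of a group by isometries on a metric space is geometric if it is proper
(each point has a ball that meets only finitely many of its translates) and cocompact. -/
structure IsGeometric {H X : Type*} [Group H] [MetricSpace X] (ρ : H →* (X ≃ᵢ X)) : Prop where
  proper : ∀ x : X, ∃ r > 0,
    {h : H | (ρ h '' Metric.ball x r ∩ Metric.ball x r).Nonempty}.Finite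
  cocompact : ∃ K : Set X, IsCompact K ∧ ⋃ h : H, ρ h '' K = Set.univ

end GrProd

end

noncomputable section

namespace GrProd

/-! ### The product of the vertex groups, retractions, and centralizers -/

section General

variable {V : Type*} {Γ : SimpleGraph V} {G : V → Type*} [∀ v, Group (G v)]

/-! The core is that `p_{v,C} ↦ π_{v,C}` defines an injective homomorphism `toAut` on `G_Γ̃`. It is
well defined because, without SIL, a component `C` of `Γ ∖ st(v)` that misses `w` lies inside the
component of `Γ ∖ st(w)` containing `v`, when `v ∉ st(w)` (`PCIndex.subset_of_notMem`). This makes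
partial conjugations that are adjacent in `Γ̃` commute (`partialConj_comm`).

For injectivity (`toAut_injective`), let `g` be in the kernel. For `u ∈ C`, the image of `g`
conjugates `G_u` by some `h` whose `v`-exponent is the `p_{v,C}`-exponent of `g`. Since `h`
centralizes `G_u`, it lies in `G_{st(u)}` (`mem_subgroupOn_star_of_commute`), and `v ∉ st(u)`, so
this exponent vanishes. Hence `g` is in the commutator subgroup. Inner automorphisms lift to a
homomorphism `innerTilde : G_Γ → G_Γ̃`, whose image is normal with abelian quotient. So `g =
innerTilde x` with `x` central in `G_Γ`. Central elements are supported on vertices adjacent to all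
others, which have no components and are killed by `innerTilde`; thus `g = 1`.

Let `P` be the image of `toAut` and `M` the group of automorphisms permuting the vertex groups. `M`
is finite, contains `Σ_Γ` and normalizes `P`. It meets `P` trivially, because `P` acts trivially on
the direct product of the vertex groups. So `G_Γ̃` is identified with the coset space `PM/M`, on
which `PM` acts: `P` by left multiplication and `M` by conjugation. This action permutes the cosets
of the vertex groups of `Γ̃` according to a symmetry of `Γ̃` (`isCellular_tildePerm`), so it
preserves the cubes and their metric.

Properness follows from finite stabilizers of cosets, since barycentric coordinates are Lipschitz.
Cocompactness already holds for `G_Γ̃`, because only finitely many clique cosets contain `1`. An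
element acting trivially is in `M` and fixes the vertex group of every vertex that is not adjacent
to all others, which gives faithfulness under the stated condition. -/

open Classical in
/-- The canonical map of the graph product onto the direct product of the vertex groups. -/
def toPi (Γ : SimpleGraph V) (G : V → Type*) [∀ v, Group (G v)] :
    GraphProduct Γ G →* ∀ v, G v :=
  lift (fun v => MonoidHom.mulSingle G v)
    fun _ _ h a b => Pi.mulSingle_commute h.ne a b

open Classical in
theorem toPi_of (v : V) (a : G v) : toPi Γ G (of Γ G v a) = Pi.mulSingle v a := by
  exact lift_of (H := ∀ v, G v) _ _ v a

theorem toPi_of_same (v : V) (a : G v) : toPi Γ G (of Γ G v a) v = a := by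
  classical
  rw [toPi_of, Pi.mulSingle_eq_same]

theorem toPi_of_ne {v w : V} (h : w ≠ v) (a : G v) : toPi Γ G (of Γ G v a) w = 1 := by
  classical
  rw [toPi_of, Pi.mulSingle_eq_of_ne h]

theorem of_injective (v : V) : Function.Injective (of Γ G v) := fun a b h => by
  rw [← toPi_of_same (Γ := Γ) v a, h, toPi_of_same]

/-- If `v ≠ w`, the two images have disjoint supports, so both elements are trivial. -/
theorem of_eq_of_toPi_eq {v w : V} {a : G v} {b : G w}
    (h : toPi Γ G (of Γ G v a) = toPi Γ G (of Γ G w b)) : of Γ G v a = of Γ G w b := by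
  by_cases hvw : v = w
  · subst hvw
    have := congrFun h v
    rw [toPi_of_same, toPi_of_same] at this
    rw [this]
  · have h1 := congrFun h v
    have h2 := congrFun h w
    rw [toPi_of_same, toPi_of_ne hvw] at h1
    rw [toPi_of_same, toPi_of_ne (Ne.symm hvw)] at h2
    rw [h1, ← h2, map_one, map_one]

open Classical in
/-- The retraction of the graph product onto `G_A`. -/
def retract (Γ : SimpleGraph V) (G : V → Type*) [∀ v, Group (G v)] (A : Set V) :
    GraphProduct Γ G →* GraphProduct Γ G :=
  lift (fun v => if v ∈ A then of Γ G v else 1) <| by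
    intro v w h a b
    by_cases hv : v ∈ A <;> by_cases hw : w ∈ A <;> simp [hv, hw, commute_of_of_adj Γ G h]

theorem retract_of_mem {A : Set V} {v : V} (hv : v ∈ A) (a : G v) :
    retract Γ G A (of Γ G v a) = of Γ G v a := by
  rw [retract, lift_of, if_pos hv]

theorem retract_of_notMem {A : Set V} {v : V} (hv : v ∉ A) (a : G v) :
    retract Γ G A (of Γ G v a) = 1 := by
  rw [retract, lift_of, if_neg hv]; rfl

theorem retract_eq_self {A : Set V} {x : GraphProduct Γ G} (hx : x ∈ subgroupOn Γ G A) :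
    retract Γ G A x = x := by
  have : subgroupOn Γ G A ≤ (retract Γ G A).eqLocus (MonoidHom.id _) := by
    refine iSup₂_le fun v hv => ?_
    rintro _ ⟨a, rfl⟩
    exact retract_of_mem hv a
  exact this hx

/-- Used to intersect: an element fixed by the retractions onto `G_A` and `G_B` is fixed by the one
onto `G_{A ∩ B}`. -/
theorem retract_retract (A B : Set V) (x : GraphProduct Γ G) :
    retract Γ G A (retract Γ G B x) = retract Γ G (A ∩ B) x := by
  suffices h : (retract Γ G A).comp (retract Γ G B) = retract Γ G (A ∩ B) from
    DFunLike.congr_fun h x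
  apply hom_ext
  intro v a
  rw [MonoidHom.comp_apply]
  by_cases hB : v ∈ B
  · rw [retract_of_mem hB]
    by_cases hA : v ∈ A
    · rw [retract_of_mem hA, retract_of_mem (A := A ∩ B) ⟨hA, hB⟩]
    · rw [retract_of_notMem hA, retract_of_notMem (A := A ∩ B) fun h => hA h.1]
  · rw [retract_of_notMem hB, retract_of_notMem (A := A ∩ B) fun h => hB h.2, map_one]

theorem toPi_eq_one_of_mem_subgroupOn {A : Set V} {x : GraphProduct Γ G}
    (hx : x ∈ subgroupOn Γ G A) {v : V} (hv : v ∉ A) : toPi Γ G x v = 1 := by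
  have : subgroupOn Γ G A ≤ ((Pi.evalMonoidHom G v).comp (toPi Γ G)).ker := by
    refine iSup₂_le fun w hw => ?_
    rintro _ ⟨a, rfl⟩
    exact toPi_of_ne (Γ := Γ) (fun h : v = w => hv (h.symm ▸ hw)) a
  exact this hx

/-! ### Counting hyperplane crossings in a wreath product, and centralizers of vertex elements -/

/-- The action of a group on the functions on the cosets of a subgroup. -/
def translate {P : Type*} [Group P] (H : Subgroup P) (A : Type*) [Group A] :
    P →* MulAut (P ⧸ H → A) where
  toFun g :=
    { toFun := fun F K => F (g⁻¹ • K)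
      invFun := fun F K => F (g • K)
      left_inv := fun F => by simp
      right_inv := fun F => by simp
      map_mul' := fun _ _ => rfl }
  map_one' := by
    ext F K
    change F ((1 : P)⁻¹ • K) = F K
    rw [inv_one, one_smul]
  map_mul' g h := by
    ext F K
    change F ((g * h)⁻¹ • K) = F (h⁻¹ • g⁻¹ • K)
    rw [mul_inv_rev, mul_smul]

open Classical in
/-- The functions supported at the base coset. -/
def baseFun {P : Type*} [Group P] (H : Subgroup P) (A : Type*) [Group A] : A →* (P ⧸ H → A) :=
  MonoidHom.mulSingle (fun _ => A) ((1 : P) : P ⧸ H)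

section Translate

variable {P : Type*} [Group P] {H : Subgroup P} {A : Type*} [Group A]

theorem translate_baseFun_one (g : P) (a : A) :
    translate H A g (baseFun H A a) ((1 : P) : P ⧸ H) = baseFun H A a ((g⁻¹ : P) : P ⧸ H) := by
  change baseFun H A a ((g⁻¹ * 1 : P) : P ⧸ H) = _
  rw [mul_one]

theorem baseFun_of_mem {g : P} (hg : g ∈ H) (a : A) : baseFun H A a (g : P ⧸ H) = a := by
  classical
  rw [show (g : P ⧸ H) = ((1 : P) : P ⧸ H) from QuotientGroup.eq.2 (by simpa using hg)]
  exact Pi.mulSingle_eq_same _ _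

theorem baseFun_of_notMem {g : P} (hg : g ∉ H) (a : A) : baseFun H A a (g : P ⧸ H) = 1 := by
  classical
  refine Pi.mulSingle_eq_of_ne (fun h => hg ?_) _
  simpa using QuotientGroup.eq.1 h

theorem translate_baseFun {g : P} (hg : g ∈ H) (a : A) :
    translate H A g (baseFun H A a) = baseFun H A a := by
  funext K
  obtain ⟨k, rfl⟩ := QuotientGroup.mk_surjective K
  change baseFun H A a ((g⁻¹ * k : P) : P ⧸ H) = _
  by_cases hk : k ∈ H
  · rw [baseFun_of_mem hk, baseFun_of_mem (mul_mem (inv_mem hg) hk)]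
  · rw [baseFun_of_notMem hk, baseFun_of_notMem]
    rwa [Subgroup.mul_mem_cancel_left _ (inv_mem hg)]

end Translate

/-- The functions on the cosets of `G_{st(u)}` (the hyperplanes of type `u`) with values in `G u`,
extended by the graph product. -/
abbrev Wreath (Γ : SimpleGraph V) (G : V → Type*) [∀ v, Group (G v)] (u : V) : Type _ :=
  (GraphProduct Γ G ⧸ subgroupOn Γ G (star Γ u) → G u) ⋊[translate _ _] GraphProduct Γ G

/-- The function is nontrivial only if `w = u`, and then `v ∈ st(u)` stabilizes the base coset. This
is what makes the vertex groups map homomorphically and compatibly with the commutation relations.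
-/
theorem translate_baseFun_of {u v w : V} (h : v = w ∨ Γ.Adj v w) (a : G v) (b : G w) :
    translate (subgroupOn Γ G (star Γ u)) (G u) (of Γ G v a)
      (baseFun _ _ (toPi Γ G (of Γ G w b) u)) = baseFun _ _ (toPi Γ G (of Γ G w b) u) := by
  by_cases hu : u = w
  · subst hu
    have hv : v ∈ star Γ u := h.imp id SimpleGraph.Adj.symm
    exact translate_baseFun (of_mem_subgroupOn hv a) _
  · rw [toPi_of_ne hu, map_one, map_one]

/-- The vertex groups in the wreath product: the elements of `G u` cross the base hyperplane. -/
def toWreathAux (Γ : SimpleGraph V) (G : V → Type*) [∀ v, Group (G v)] (u w : V) :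
    G w →* Wreath Γ G u where
  toFun a := ⟨baseFun _ _ (toPi Γ G (of Γ G w a) u), of Γ G w a⟩
  map_one' := by
    rw [map_one, map_one, Pi.one_apply, map_one]; rfl
  map_mul' a b := by
    refine SemidirectProduct.ext ?_ (map_mul _ a b)
    rw [SemidirectProduct.mul_left]
    dsimp only
    rw [translate_baseFun_of (Or.inl rfl), ← map_mul, ← Pi.mul_apply, ← map_mul, ← map_mul]

theorem commute_toWreathAux (u v w : V) (h : Γ.Adj v w) (a : G v) (b : G w) :
    Commute (toWreathAux Γ G u v a) (toWreathAux Γ G u w b) := by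
  refine SemidirectProduct.ext ?_ (commute_of_of_adj Γ G h a b)
  rw [SemidirectProduct.mul_left, SemidirectProduct.mul_left]
  dsimp only [toWreathAux, MonoidHom.coe_mk, OneHom.coe_mk]
  rw [translate_baseFun_of (Or.inr h), translate_baseFun_of (Or.inr h.symm),
    ← map_mul, ← map_mul, ← Pi.mul_apply, ← Pi.mul_apply, ← map_mul, ← map_mul,
    (commute_of_of_adj Γ G h a b).eq]

/-- The homomorphism to the wreath product that records the crossings of hyperplanes
of type `u`. -/
def toWreath (Γ : SimpleGraph V) (G : V → Type*) [∀ v, Group (G v)] (u : V) :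
    GraphProduct Γ G →* Wreath Γ G u :=
  lift (toWreathAux Γ G u) (commute_toWreathAux u)

theorem toWreath_right (u : V) (x : GraphProduct Γ G) : (toWreath Γ G u x).right = x := by
  suffices h : SemidirectProduct.rightHom.comp (toWreath Γ G u) = MonoidHom.id _ from
    DFunLike.congr_fun h x
  apply hom_ext
  intro v a
  rw [MonoidHom.comp_apply, toWreath, lift_of]
  rfl

/-- The centralizer of a nontrivial element of `G u` is contained in `G_{st(u)}`. -/
theorem mem_subgroupOn_star_of_commute {u : V} {a : G u} (ha : a ≠ 1) {x : GraphProduct Γ G}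
    (hx : Commute x (of Γ G u a)) : x ∈ subgroupOn Γ G (star Γ u) := by
  by_contra hxs
  have h := congrArg SemidirectProduct.left (hx.map (toWreath Γ G u)).eq
  rw [SemidirectProduct.mul_left, SemidirectProduct.mul_left, toWreath_right] at h
  have hl : toWreath Γ G u (of Γ G u a) = ⟨baseFun _ _ a, of Γ G u a⟩ := by
    rw [toWreath, lift_of]
    change (⟨baseFun _ _ (toPi Γ G (of Γ G u a) u), of Γ G u a⟩ : Wreath Γ G u) = _
    rw [toPi_of_same]
  rw [hl] at h
  dsimp only at h
  set F := (toWreath Γ G u x).left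
  -- Comparing `xa = ax` at the base coset: as `x ∉ G_{st(u)}`, the crossing contributed by `a` on
  -- the left side sits at another coset, while on the right side it sits at the base coset, which
  -- `a` fixes. This leaves `F(1) = a * F(1)`.
  have h1 := congrFun h ((1 : GraphProduct Γ G) : GraphProduct Γ G ⧸ subgroupOn Γ G (star Γ u))
  rw [Pi.mul_apply, Pi.mul_apply, translate_baseFun_one, baseFun_of_mem (one_mem _),
    baseFun_of_notMem (fun h' => hxs (by simpa using h')), mul_one] at h1
  have h2 : (((of Γ G u a)⁻¹ * 1 : GraphProduct Γ G) : GraphProduct Γ G ⧸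
      subgroupOn Γ G (star Γ u)) = ((1 : GraphProduct Γ G) : _ ⧸ subgroupOn Γ G (star Γ u)) := by
    rw [QuotientGroup.eq]
    simpa using of_mem_subgroupOn (Γ := Γ) (G := G) (T := star Γ u) (Or.inl rfl) a
  have h3 : translate (subgroupOn Γ G (star Γ u)) (G u) (of Γ G u a) F
      ((1 : GraphProduct Γ G) : GraphProduct Γ G ⧸ subgroupOn Γ G (star Γ u)) =
      F ((1 : GraphProduct Γ G) : GraphProduct Γ G ⧸ subgroupOn Γ G (star Γ u)) :=
    congrArg F h2
  rw [h3] at h1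
  exact ha (right_eq_mul.1 h1)

end General

/-! ### Components of complements of stars -/

section Components

variable {V : Type*} {Γ : SimpleGraph V}

theorem _root_.SimpleGraph.Reachable.closed {W : Type*} {H : SimpleGraph W} {P : W → Prop}
    (h : ∀ x y, H.Adj x y → P x → P y) {a b : W} (hr : H.Reachable a b) (ha : P a) : P b := by
  obtain ⟨p⟩ := hr
  induction p with
  | nil => exact ha
  | cons hadj _ ih => exact ih (h _ _ hadj ha)

theorem two_le_edist_iff {v w : V} : 2 ≤ Γ.edist v w ↔ v ≠ w ∧ ¬ Γ.Adj v w := by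
  rw [← SimpleGraph.edist_eq_one_iff_adj, Ne, ← SimpleGraph.edist_eq_zero_iff (G := Γ)]
  induction Γ.edist v w using ENat.recTopCoe with
  | top => simp
  | coe k => norm_cast; omega

theorem notMem_star_iff {v w : V} : w ∉ star Γ v ↔ v ≠ w ∧ ¬ Γ.Adj v w := by
  simp [star, eq_comm]

theorem notMem_star_symm {v w : V} (h : w ∉ star Γ v) : v ∉ star Γ w := by
  rw [notMem_star_iff] at h ⊢
  exact ⟨h.1.symm, fun h' => h.2 h'.symm⟩

/-- The component of `u` in the complement of the star of `v`. -/
def PCIndex.ofMem {v u : V} (hu : u ∉ star Γ v) : PCIndex Γ :=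
  ⟨v, (Γ.induce (star Γ v)ᶜ).connectedComponentMk ⟨u, hu⟩⟩

theorem PCIndex.mem_ofMem {v u : V} (hu : u ∉ star Γ v) : u ∈ (PCIndex.ofMem hu).verts :=
  ⟨⟨u, hu⟩, rfl, rfl⟩

theorem PCIndex.verts_nonempty (p : PCIndex Γ) : p.verts.Nonempty := by
  obtain ⟨u, hu⟩ := p.2.nonempty_supp
  exact ⟨u, u, hu, rfl⟩

theorem PCIndex.fst_notMem_verts (p : PCIndex Γ) : p.1 ∉ p.verts :=
  fun h => PCIndex.not_mem_star h (Or.inl rfl)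

/-- Distinct components of the same `Γ ∖ st(v)` are disjoint. This is how two pairs are recognized
as equal throughout. -/
theorem PCIndex.ext_of_mem {p q : PCIndex Γ} (h : p.1 = q.1) {u : V} (hp : u ∈ p.verts)
    (hq : u ∈ q.verts) : p = q := by
  obtain ⟨v, C⟩ := p
  obtain ⟨w, D⟩ := q
  dsimp only at h
  subst h
  obtain ⟨x, hx, rfl⟩ := hp
  obtain ⟨y, hy, hxy⟩ := hq
  obtain rfl := Subtype.ext hxy
  rw [SimpleGraph.ConnectedComponent.mem_supp_iff] at hx hy
  dsimp only at hx hy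
  rw [← hx, ← hy]

theorem PCIndex.mem_of_adj {p : PCIndex Γ} {x y : V} (hx : x ∈ p.verts) (h : Γ.Adj x y)
    (hy : ¬ Γ.Adj p.1 y) : y ∈ p.verts := by
  by_contra hy'
  exact hy (PCIndex.mem_star_of_adj hx hy' h)

theorem PCIndex.closed {p : PCIndex Γ} {P : V → Prop}
    (h : ∀ x ∈ p.verts, ∀ y ∈ p.verts, Γ.Adj x y → P x → P y) {a b : V} (ha : a ∈ p.verts)
    (hb : b ∈ p.verts) (hP : P a) : P b := by
  obtain ⟨a, ha, rfl⟩ := ha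
  obtain ⟨b, hb, rfl⟩ := hb
  rw [SimpleGraph.ConnectedComponent.mem_supp_iff] at ha hb
  have hr : (Γ.induce (star Γ p.1)ᶜ).Reachable a b :=
    SimpleGraph.ConnectedComponent.eq.1 (ha.trans hb.symm)
  have hm : a.1 ∈ p.verts := ⟨a, ha, rfl⟩
  refine (SimpleGraph.Reachable.closed (P := fun x => x.1 ∈ p.verts ∧ P x.1) ?_ hr ⟨hm, hP⟩).2
  rintro x y hxy ⟨hx, hPx⟩
  have hy : y.1 ∈ p.verts := PCIndex.mem_of_adj hx hxy fun h' => y.2 (Or.inr h')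
  exact ⟨hy, h _ hx _ hy hxy hPx⟩

/-- Without separating intersections of links, every component of `Γ ∖ st(v)` that does not
contain `w` is contained in the component of `v` in `Γ ∖ st(w)`. -/
theorem PCIndex.subset_of_notMem (hΓ : ¬ HasSIL Γ) {p q : PCIndex Γ} (hv : p.1 ∈ q.verts)
    (hw : q.1 ∉ p.verts) : p.verts ⊆ q.verts := by
  have hvw := PCIndex.not_mem_star hv
  have hwv := notMem_star_symm hvw
  rw [notMem_star_iff] at hvw hwv
  have hst : ∀ x ∈ p.verts, ¬ Γ.Adj q.1 x := fun x hx h =>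
    hw (PCIndex.mem_of_adj hx h.symm hwv.2)
  have hclosed : ∀ c ∈ p.verts, c ∈ q.verts → p.verts ⊆ q.verts := fun c hc hcq d hd =>
    PCIndex.closed (P := (· ∈ q.verts))
      (fun x _ y hy hxy hx => PCIndex.mem_of_adj hx hxy (hst y hy)) hc hd hcq
  by_contra hnot
  have hdisj : ∀ c ∈ p.verts, c ∉ q.verts := fun c hc hcq => hnot (hclosed c hc hcq)
  obtain ⟨c, hc⟩ := p.verts_nonempty
  have hcn : c ∉ Γ.neighborSet p.1 ∩ Γ.neighborSet q.1 := fun h => hst c hc h.2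
  -- If `C` is not contained in `D`, it is disjoint from it, as no vertex of `C` is adjacent to `w`.
  -- The component of a point of `C` in `Γ ∖ (lk(v) ∩ lk(w))` then stays in `C`, so it contains
  -- neither `v` nor `w`: a SIL.
  refine hΓ ⟨p.1, q.1, two_le_edist_iff.2 hwv, (Γ.induce _).connectedComponentMk ⟨c, hcn⟩, ?_⟩
  have hK : ∀ y ∈ Subtype.val '' ((Γ.induce
      (Γ.neighborSet p.1 ∩ Γ.neighborSet q.1)ᶜ).connectedComponentMk ⟨c, hcn⟩).supp,
      y ∈ p.verts := by
    rintro _ ⟨y, hy, rfl⟩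
    rw [SimpleGraph.ConnectedComponent.mem_supp_iff, SimpleGraph.ConnectedComponent.eq] at hy
    refine SimpleGraph.Reachable.closed (P := fun x => x.1 ∈ p.verts) ?_ hy.symm hc
    intro x y hxy hx
    by_contra hy
    have hvy := PCIndex.mem_star_of_adj hx hy hxy
    have hyq : ¬ Γ.Adj q.1 y := fun h => y.2 ⟨hvy, h⟩
    -- An edge leaving `C` ends in some `y ∈ lk(v) ∖ lk(w)`. The path `v, y, x` avoids `st(w)`, so
    -- it would place `x` in `D`.
    exact hdisj _ hx (PCIndex.mem_of_adj (PCIndex.mem_of_adj hv hvy hyq) hxy.symm (hst _ hx))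
  exact ⟨fun h => p.fst_notMem_verts (hK _ h), fun h => hw (hK _ h)⟩

/-- The distance condition is automatic: `v ∈ D` already puts `v` outside `st(w)`. -/
theorem tildeGraph_adj_iff {p q : PCIndex Γ} :
    (tildeGraph Γ).Adj p q ↔ p ≠ q ∧ ¬ (p.1 ∈ q.verts ∧ q.1 ∈ p.verts) := by
  refine and_congr_right fun _ => not_congr (and_iff_right_of_imp fun h => ?_)
  exact two_le_edist_iff.2 (notMem_star_iff.1 (PCIndex.not_mem_star h.2))

/-- Otherwise `v ∉ st(w)`, and the component of `v` in `Γ ∖ st(w)` contains `C`; it therefore meets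
`D` and equals it, contradicting `v ∉ D`. -/
theorem PCIndex.not_mem_both (hΓ : ¬ HasSIL Γ) {p q : PCIndex Γ} (hpq : p ≠ q)
    (hv : p.1 ∉ q.verts) (hw : q.1 ∉ p.verts) {u : V} (hup : u ∈ p.verts) (huq : u ∈ q.verts) :
    Γ.Adj p.1 q.1 := by
  by_contra h
  have hne : p.1 ≠ q.1 := fun h' => hpq (PCIndex.ext_of_mem h' hup huq)
  have hs : p.1 ∉ star Γ q.1 := notMem_star_symm (notMem_star_iff.2 ⟨hne, h⟩)
  have hsub := PCIndex.subset_of_notMem hΓ (p := p) (q := PCIndex.ofMem hs)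
    (PCIndex.mem_ofMem hs) hw
  have := PCIndex.ext_of_mem (p := PCIndex.ofMem hs) (q := q) rfl (hsub hup) huq
  exact hv (this ▸ PCIndex.mem_ofMem hs)

end Components

/-! ### The homomorphism from the graph product over `Γ̃` -/

section Tilde

variable {V : Type*} {Γ : SimpleGraph V} {G : V → Type*} [∀ v, Group (G v)]

theorem partialConj_of_mem {p : PCIndex Γ} (a : G p.1) {u : V} (hu : u ∈ p.verts) (x : G u) :
    partialConj Γ G p a (of Γ G u x) = of Γ G p.1 a * of Γ G u x * (of Γ G p.1 a)⁻¹ :=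
  partialConjHom_of_mem a hu x

theorem partialConj_of_notMem {p : PCIndex Γ} (a : G p.1) {u : V} (hu : u ∉ p.verts) (x : G u) :
    partialConj Γ G p a (of Γ G u x) = of Γ G u x :=
  partialConjHom_of_notMem a hu x

theorem mulAut_ext {f g : MulAut (GraphProduct Γ G)}
    (h : ∀ v (a : G v), f (of Γ G v a) = g (of Γ G v a)) : f = g :=
  MulEquiv.toMonoidHom_injective (hom_ext (f := f.toMonoidHom) (g := g.toMonoidHom) h)

/-- Partial conjugation as a homomorphism from the vertex group. -/
def partialConjMulHom (hc : ∀ v (a b : G v), Commute a b) (p : PCIndex Γ) :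
    G p.1 →* MulAut (GraphProduct Γ G) :=
  MonoidHom.mk' (partialConj Γ G p) <| by
    intro a b
    apply mulAut_ext
    intro u x
    rw [MulAut.mul_apply]
    by_cases hu : u ∈ p.verts
    -- Composing partial conjugations reverses the factors, because `a` is inserted inside the
    -- conjugation by the fixed element `b`; commutativity of the vertex group restores the order.
    · rw [(hc _ a b).eq, partialConj_of_mem _ hu, partialConj_of_mem _ hu, map_mul, map_mul,
        map_mul, map_inv,
        partialConj_of_notMem _ p.fst_notMem_verts, partialConj_of_mem _ hu]
      group
    · rw [partialConj_of_notMem _ hu, partialConj_of_notMem _ hu, partialConj_of_notMem _ hu]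

/-- Here `C ⊆ D`, so the second map conjugates both `v` and `C` by `b`, and the first fixes `b`. On
`C`, either composite is conjugation by `b * a`. -/
theorem partialConj_comm_of_mem (hΓ : ¬ HasSIL Γ) {p q : PCIndex Γ} (hv : p.1 ∈ q.verts)
    (hw : q.1 ∉ p.verts) (a : G p.1) (b : G q.1) :
    Commute (partialConj Γ G p a) (partialConj Γ G q b) := by
  apply mulAut_ext
  intro u x
  rw [MulAut.mul_apply, MulAut.mul_apply]
  by_cases hu : u ∈ p.verts
  · rw [partialConj_of_mem b (PCIndex.subset_of_notMem hΓ hv hw hu), partialConj_of_mem a hu,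
      map_mul, map_mul, map_mul, map_mul, map_inv, map_inv, partialConj_of_notMem a hw,
      partialConj_of_mem a hu, partialConj_of_mem b hv,
      partialConj_of_mem b (PCIndex.subset_of_notMem hΓ hv hw hu)]
    group
  · rw [partialConj_of_notMem a hu]
    by_cases hu' : u ∈ q.verts
    · rw [partialConj_of_mem b hu', map_mul, map_mul, map_inv, partialConj_of_notMem a hu,
        partialConj_of_notMem a hw]
    · rw [partialConj_of_notMem b hu', partialConj_of_notMem a hu]

/-- Without separating intersections of links, partial conjugations that are adjacent in `Γ̃`
commute. -/
theorem partialConj_comm (hΓ : ¬ HasSIL Γ) {p q : PCIndex Γ} (h : (tildeGraph Γ).Adj p q)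
    (a : G p.1) (b : G q.1) : Commute (partialConj Γ G p a) (partialConj Γ G q b) := by
  rw [tildeGraph_adj_iff] at h
  by_cases hv : p.1 ∈ q.verts
  · exact partialConj_comm_of_mem hΓ hv (fun hw => h.2 ⟨hv, hw⟩) a b
  by_cases hw : q.1 ∈ p.verts
  · exact (partialConj_comm_of_mem hΓ hw hv b a).symm
  apply mulAut_ext
  intro u x
  rw [MulAut.mul_apply, MulAut.mul_apply]
  by_cases hu : u ∈ p.verts <;> by_cases hu' : u ∈ q.verts
  · have hc : of Γ G p.1 a * of Γ G q.1 b = of Γ G q.1 b * of Γ G p.1 a :=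
      commute_of_of_adj Γ G (PCIndex.not_mem_both hΓ h.1 hv hw hu hu') a b
    rw [partialConj_of_mem b hu', partialConj_of_mem a hu, map_mul, map_mul, map_mul, map_mul,
      map_inv, map_inv, partialConj_of_notMem a hw, partialConj_of_notMem b hv,
      partialConj_of_mem a hu, partialConj_of_mem b hu']
    -- On a vertex in both components the two composites are conjugation by `b * a` and by `a * b`,
    -- which agree as `v` and `w` are adjacent.
    have h1 : ∀ g h x : GraphProduct Γ G, g * (h * x * h⁻¹) * g⁻¹ = (g * h) * x * (g * h)⁻¹ := by
      intro g h x; group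
    rw [h1, h1, hc]
  · rw [partialConj_of_notMem b hu', partialConj_of_mem a hu, map_mul, map_mul, map_inv,
      partialConj_of_notMem b hu', partialConj_of_notMem b hv]
  · rw [partialConj_of_mem b hu', partialConj_of_notMem a hu, partialConj_of_mem b hu', map_mul,
      map_mul, map_inv, partialConj_of_notMem a hu, partialConj_of_notMem a hw]
  · rw [partialConj_of_notMem b hu', partialConj_of_notMem a hu, partialConj_of_notMem b hu']

/-- The graph product over `Γ̃` in which `p_{v,C}` carries a copy of `G v`. -/
abbrev TildeProd (Γ : SimpleGraph V) (G : V → Type*) [∀ v, Group (G v)] : Type _ :=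
  GraphProduct (tildeGraph Γ) (fun p : PCIndex Γ => G p.1)

/-- The vertex groups of the graph product over `Γ̃`. -/
def tof (Γ : SimpleGraph V) (G : V → Type*) [∀ v, Group (G v)] (p : PCIndex Γ) :
    G p.1 →* TildeProd Γ G :=
  of (tildeGraph Γ) (fun p : PCIndex Γ => G p.1) p

theorem TildeProd.induction_of {motive : TildeProd Γ G → Prop} (w : TildeProd Γ G)
    (one : motive 1) (of : ∀ p (a : G p.1), motive (tof Γ G p a))
    (mul : ∀ u w, motive u → motive w → motive (u * w)) : motive w :=
  GrProd.induction_of w one of mul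

theorem toPi_tof_same (p : PCIndex Γ) (a : G p.1) :
    toPi (tildeGraph Γ) (fun p : PCIndex Γ => G p.1) (tof Γ G p a) p = a :=
  toPi_of_same (Γ := tildeGraph Γ) (G := fun p : PCIndex Γ => G p.1) p a

theorem toPi_tof_ne {p q : PCIndex Γ} (h : q ≠ p) (a : G p.1) :
    toPi (tildeGraph Γ) (fun p : PCIndex Γ => G p.1) (tof Γ G p a) q = 1 :=
  toPi_of_ne (Γ := tildeGraph Γ) (G := fun p : PCIndex Γ => G p.1) h a

/-- Includes the case `p = q`, which is not an edge of `Γ̃`; commutativity of the vertex group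
covers it. -/
theorem commute_tof (hc : ∀ v (a b : G v), Commute a b) {p q : PCIndex Γ}
    (h : ¬ (p.1 ∈ q.verts ∧ q.1 ∈ p.verts)) (a : G p.1) (b : G q.1) :
    Commute (tof Γ G p a) (tof Γ G q b) := by
  by_cases hpq : p = q
  · subst hpq
    exact (hc _ a b).map (tof Γ G p)
  · exact commute_of_of_adj (tildeGraph Γ) (fun p : PCIndex Γ => G p.1)
      (tildeGraph_adj_iff.2 ⟨hpq, h⟩) a b

/-- The homomorphism from the graph product over `Γ̃` that sends `p_{v,C}` to `π_{v,C}`. -/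
def toAut (hΓ : ¬ HasSIL Γ) (hc : ∀ v (a b : G v), Commute a b) :
    TildeProd Γ G →* MulAut (GraphProduct Γ G) :=
  lift (partialConjMulHom hc) fun _ _ h a b => partialConj_comm hΓ h a b

theorem toAut_tof (hΓ : ¬ HasSIL Γ) (hc : ∀ v (a b : G v), Commute a b) (p : PCIndex Γ)
    (a : G p.1) :
    toAut hΓ hc (tof Γ G p a) = partialConj Γ G p a := by
  exact lift_of (G := fun p : PCIndex Γ => G p.1) (partialConjMulHom hc) _ p a

end Tilde

/-- Both sides are homomorphisms into an abelian group that agree on the vertex groups. So the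
abelianization map factors through `toPi`. -/
theorem abelianization_of_eq {V : Type*} [Fintype V] {Γ : SimpleGraph V} {G : V → Type*}
    [∀ v, Group (G v)] (g : GraphProduct Γ G) :
    Abelianization.of g = ∏ v, Abelianization.of (of Γ G v (toPi Γ G g v)) := by
  classical
  suffices h : Abelianization.of = ∏ v, ((Abelianization.of.comp (of Γ G v)).comp
      (Pi.evalMonoidHom G v)).comp (toPi Γ G) by
    rw [h, MonoidHom.finsetProd_apply]
    refine Finset.prod_congr rfl fun v _ => ?_
    rw [← h]
    rfl
  apply hom_ext
  intro v a
  rw [MonoidHom.finsetProd_apply, Finset.prod_eq_single v]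
  · change _ = Abelianization.of (of Γ G v (toPi Γ G (of Γ G v a) v))
    rw [toPi_of_same]
  · intro w _ hw
    change Abelianization.of (of Γ G w (toPi Γ G (of Γ G v a) w)) = _
    rw [toPi_of_ne hw, map_one, map_one]
  · simp

/-- The kernel of the map to the product of the vertex groups lies in the commutator subgroup. -/
theorem mem_commutator_of_toPi_eq_one {V : Type*} [Finite V] {Γ : SimpleGraph V} {G : V → Type*}
    [∀ v, Group (G v)] {g : GraphProduct Γ G} (hg : toPi Γ G g = 1) :
    g ∈ commutator (GraphProduct Γ G) := by
  have := Fintype.ofFinite V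
  rw [← Abelianization.ker_of, MonoidHom.mem_ker, abelianization_of_eq, hg]
  simp

/-! ### Exponents of partial conjugations read off from their action on vertex groups -/

section Exponents

variable {V : Type*} {Γ : SimpleGraph V} {G : V → Type*} [∀ v, Group (G v)]

theorem toPi_conj (hc : ∀ v (a b : G v), Commute a b) (h x : GraphProduct Γ G) :
    toPi Γ G (h * x * h⁻¹) = toPi Γ G x := by
  funext v
  rw [map_mul, map_mul, map_inv, Pi.mul_apply, Pi.mul_apply, Pi.inv_apply, (hc v _ _).eq,
    inv_mul_cancel_left]

/-- Conjugation is invisible in a product of abelian groups. This invariant separates partial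
conjugations from monomial automorphisms. -/
theorem toPi_partialConj (hc : ∀ v (a b : G v), Commute a b) (p : PCIndex Γ) (a : G p.1)
    (x : GraphProduct Γ G) : toPi Γ G (partialConj Γ G p a x) = toPi Γ G x := by
  suffices h : (toPi Γ G).comp (partialConj Γ G p a).toMonoidHom = toPi Γ G from
    DFunLike.congr_fun h x
  apply hom_ext
  intro u y
  change toPi Γ G (partialConj Γ G p a (of Γ G u y)) = _
  by_cases hu : u ∈ p.verts
  · rw [partialConj_of_mem a hu, toPi_conj hc]
  · rw [partialConj_of_notMem a hu]

theorem toPi_toAut (hΓ : ¬ HasSIL Γ) (hc : ∀ v (a b : G v), Commute a b) (g : TildeProd Γ G)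
    (x : GraphProduct Γ G) : toPi Γ G (toAut hΓ hc g x) = toPi Γ G x := by
  induction g using TildeProd.induction_of generalizing x with
  | one => simp
  | mul g h hg hh => rw [map_mul, MulAut.mul_apply, hg, hh]
  | of p a => rw [toAut_tof, toPi_partialConj hc]

/-- The image of a vertex group under a product of partial conjugations is conjugate to it, and
the exponents of the conjugating element are determined by the partial conjugations. -/
theorem exists_toAut_of_eq (hΓ : ¬ HasSIL Γ) (hc : ∀ v (a b : G v), Commute a b)
    (g : TildeProd Γ G) (u : V) : ∃ h : GraphProduct Γ G,
      (∀ x, toAut hΓ hc g (of Γ G u x) = h * of Γ G u x * h⁻¹) ∧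
      ∀ p : PCIndex Γ, u ∈ p.verts → toPi Γ G h p.1 =
        toPi (tildeGraph Γ) (fun p : PCIndex Γ => G p.1) g p := by
  induction g using TildeProd.induction_of with
  | one => exact ⟨1, by simp, by simp⟩
  | mul g₁ g₂ h₁ h₂ =>
    obtain ⟨k₁, hk₁, hk₁'⟩ := h₁
    obtain ⟨k₂, hk₂, hk₂'⟩ := h₂
    -- The exponents of `k₂` survive the application of `toAut g₁`, so the exponents of the
    -- conjugators multiply.
    refine ⟨toAut hΓ hc g₁ k₂ * k₁, fun x => ?_, fun p hp => ?_⟩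
    · rw [map_mul, MulAut.mul_apply, hk₂, map_mul, map_mul, map_inv, hk₁]
      group
    · rw [map_mul, map_mul, Pi.mul_apply, Pi.mul_apply, toPi_toAut, hk₁' p hp, hk₂' p hp]
      exact hc _ _ _
  | of q b =>
    by_cases hu : u ∈ q.verts
    · refine ⟨of Γ G q.1 b, fun x => ?_, fun p hp => ?_⟩
      · rw [toAut_tof, partialConj_of_mem b hu]
      · by_cases hpq : p = q
        · subst hpq
          rw [toPi_of_same, toPi_tof_same]
        · rw [toPi_tof_ne hpq, toPi_of_ne fun h => hpq (PCIndex.ext_of_mem h hp hu)]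
    · refine ⟨1, fun x => ?_, fun p hp => ?_⟩
      · rw [toAut_tof, partialConj_of_notMem b hu]; simp
      · rw [toPi_tof_ne (by rintro rfl; exact hu hp), map_one, Pi.one_apply]

end Exponents

/-! ### Lifting inner automorphisms to the graph product over `Γ̃`, and injectivity -/

section Inner

variable {V : Type*} [Finite V] {Γ : SimpleGraph V} {G : V → Type*} [∀ v, Group (G v)]

open Classical in
/-- The product over all components `C` of `Γ ∖ st(v)` of given elements of the vertex groups
at `p_{v,C}`. -/
def prodTof (hc : ∀ v (a b : G v), Commute a b) (v : V) :
    ((Γ.induce (star Γ v)ᶜ).ConnectedComponent → G v) →* TildeProd Γ G :=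
  letI := Fintype.ofFinite (Γ.induce (star Γ v)ᶜ).ConnectedComponent
  MonoidHom.noncommPiCoprod (N := fun _ => G v) (fun C => tof Γ G ⟨v, C⟩)
    fun C D _ a b => commute_tof hc (p := ⟨v, C⟩) (q := ⟨v, D⟩)
      (fun h => PCIndex.fst_notMem_verts ⟨v, D⟩ h.1) a b

/-- Properties of the noncommutative product are checked factor by factor by encoding them as
membership in a subgroup: a centralizer, the preimage of a stabilizer, or the trivial subgroup. -/
theorem prodTof_mem (hc : ∀ v (a b : G v), Commute a b) {v : V}
    {f : (Γ.induce (star Γ v)ᶜ).ConnectedComponent → G v} {K : Subgroup (TildeProd Γ G)}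
    (h : ∀ C, tof Γ G ⟨v, C⟩ (f C) ∈ K) : prodTof hc v f ∈ K :=
  let := Fintype.ofFinite (Γ.induce (star Γ v)ᶜ).ConnectedComponent
  Subgroup.noncommProd_mem K (t := Finset.univ) (f := fun C => tof Γ G ⟨v, C⟩ (f C))
    (fun C _ D _ _ => commute_tof hc (p := ⟨v, C⟩) (q := ⟨v, D⟩)
      (fun h => PCIndex.fst_notMem_verts ⟨v, D⟩ h.1) _ _) fun C _ => h C

/-- A factor of `prodTof` can be split off. -/
theorem exists_prodTof_eq (hc : ∀ v (a b : G v), Commute a b) (p : PCIndex Γ)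
    (a : G p.1) : ∃ r, prodTof hc p.1 (fun _ => a) = tof Γ G p a * r ∧
      ∀ K : Subgroup (TildeProd Γ G),
        (∀ q : PCIndex Γ, ∀ b : G q.1, q ≠ p → q.1 = p.1 → tof Γ G q b ∈ K) → r ∈ K := by
  classical
  obtain ⟨v, C⟩ := p
  refine ⟨prodTof hc v (Function.update (fun _ => a) C 1), ?_, fun K hK => prodTof_mem hc ?_⟩
  · have h : (fun _ => a) = (Pi.mulSingle C a *
        Function.update (fun _ => a) C 1 : (Γ.induce (star Γ v)ᶜ).ConnectedComponent → G v) := by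
      funext D
      by_cases hD : D = C
      · subst hD; simp
      · simp [hD]
    conv_lhs => rw [h, map_mul]
    congr 1
    let := Fintype.ofFinite (Γ.induce (star Γ v)ᶜ).ConnectedComponent
    exact MonoidHom.noncommPiCoprod_mulSingle (N := fun _ => G v) _ C a
  · intro D
    by_cases hD : D = C
    · subst hD
      rw [Function.update_self, map_one]
      exact one_mem _
    · exact hK ⟨v, D⟩ _ (fun h => hD (by simpa using h)) rfl

/-- A factor `p_{v,C}` can fail to commute with `p_{w,D}` only if `v ∈ D`. -/
theorem commute_prodTof (hc : ∀ v (a b : G v), Commute a b) {v : V} (a : G v) {q : PCIndex Γ}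
    (hv : v ∉ q.verts) (b : G q.1) : Commute (prodTof hc v fun _ => a) (tof Γ G q b) := by
  have : prodTof hc v (fun _ => a) ∈ Subgroup.centralizer {tof Γ G q b} := by
    refine prodTof_mem hc fun C => Subgroup.mem_centralizer_singleton_iff.2 ?_
    exact (commute_tof hc (p := ⟨v, C⟩) (fun h => hv h.1) a b).eq
  exact Subgroup.mem_centralizer_singleton_iff.1 this

/-- The homomorphism from `G_Γ` to the graph product over `Γ̃` that represents the inner
automorphisms. -/
def innerTilde (hc : ∀ v (a b : G v), Commute a b) : GraphProduct Γ G →* TildeProd Γ G :=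
  lift (fun v => (prodTof hc v).comp (Pi.constMonoidHom _ (G v))) <| by
    intro v w h a b
    have : prodTof hc w (fun _ => b) ∈ Subgroup.centralizer {prodTof (Γ := Γ) hc v fun _ => a} := by
      refine prodTof_mem hc fun C => Subgroup.mem_centralizer_singleton_iff.2 ?_
      exact (commute_prodTof hc (q := ⟨w, C⟩) a
        (fun h' => PCIndex.not_mem_star h' (Or.inr h.symm)) b).eq.symm
    exact (Subgroup.mem_centralizer_singleton_iff.1 this).symm

theorem innerTilde_of (hc : ∀ v (a b : G v), Commute a b) (v : V) (a : G v) :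
    innerTilde hc (of Γ G v a) = prodTof hc v fun _ => a := by
  exact lift_of (fun v => (prodTof hc v).comp (Pi.constMonoidHom _ (G v))) _ v a

/-- A vertex `u ∉ st(v)` lies in exactly one component of `Γ ∖ st(v)`, so exactly one factor
conjugates it. If `u ∈ st(v)`, every factor fixes `G_u`, and so does conjugation by `a`. -/
theorem toAut_innerTilde (hΓ : ¬ HasSIL Γ) (hc : ∀ v (a b : G v), Commute a b)
    (x : GraphProduct Γ G) : toAut hΓ hc (innerTilde hc x) = MulAut.conj x := by
  suffices h : (toAut hΓ hc).comp (innerTilde hc) = MulAut.conj from DFunLike.congr_fun h x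
  apply hom_ext
  intro v a
  rw [MonoidHom.comp_apply, innerTilde_of]
  apply mulAut_ext
  intro u y
  have hfix : ∀ q : PCIndex Γ, ∀ b, u ∉ q.verts → tof Γ G q b ∈
      (MulAction.stabilizer (MulAut (GraphProduct Γ G)) (of Γ G u y)).comap (toAut hΓ hc) := by
    intro q b hu
    rw [Subgroup.mem_comap, MulAction.mem_stabilizer_iff, MulAut.smul_def, toAut_tof,
      partialConj_of_notMem b hu]
  rw [MulAut.conj_apply]
  by_cases hu : u ∈ star Γ v
  · have h1 := prodTof_mem hc (f := fun _ => a) fun C =>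
      hfix ⟨v, C⟩ a fun h => PCIndex.not_mem_star h hu
    rw [Subgroup.mem_comap, MulAction.mem_stabilizer_iff, MulAut.smul_def] at h1
    rw [h1, eq_mul_inv_iff_mul_eq]
    rcases hu with rfl | hu
    · rw [← map_mul, ← map_mul, (hc _ y a).eq]
    · exact (commute_of_of_adj Γ G hu a y).eq.symm
  · obtain ⟨p, rfl, hup⟩ : ∃ p : PCIndex Γ, p.1 = v ∧ u ∈ p.verts :=
      ⟨PCIndex.ofMem hu, rfl, PCIndex.mem_ofMem hu⟩
    obtain ⟨r, hr, hr'⟩ := exists_prodTof_eq hc p a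
    have h1 := hr' _ fun q b hq hq' => hfix q b fun h => hq (PCIndex.ext_of_mem hq' h hup)
    rw [Subgroup.mem_comap, MulAction.mem_stabilizer_iff, MulAut.smul_def] at h1
    rw [hr, map_mul, MulAut.mul_apply, h1, toAut_tof, partialConj_of_mem a hup]

/-- The image of `innerTilde` is normalized through the action on `G_Γ`. -/
theorem conj_innerTilde (hΓ : ¬ HasSIL Γ) (hc : ∀ v (a b : G v), Commute a b)
    (g : TildeProd Γ G) (x : GraphProduct Γ G) :
    g * innerTilde hc x * g⁻¹ = innerTilde hc (toAut hΓ hc g x) := by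
  induction g using TildeProd.induction_of generalizing x with
  | one => simp
  | mul g h hg hh =>
    rw [map_mul, MulAut.mul_apply, ← hg, ← hh]
    group
  | of q b =>
    suffices h : (MulAut.conj (tof Γ G q b)).toMonoidHom.comp (innerTilde hc) =
        (innerTilde hc).comp (toAut hΓ hc (tof Γ G q b)).toMonoidHom from DFunLike.congr_fun h x
    apply hom_ext
    intro v a
    change tof Γ G q b * innerTilde hc (of Γ G v a) * (tof Γ G q b)⁻¹ =
      innerTilde hc (toAut hΓ hc (tof Γ G q b) (of Γ G v a))
    rw [toAut_tof]
    by_cases hv : v ∈ q.verts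
    · rw [partialConj_of_mem b hv, map_mul, map_mul, map_inv, innerTilde_of, innerTilde_of]
      obtain ⟨r, hr, hr'⟩ := exists_prodTof_eq hc q b
      -- The remaining factors `p_{w,D'}`, `D' ≠ D`, have `v ∉ D'` and commute with the lift of `a`.
      -- Conjugating by `p_{w,D}` alone is therefore the same as conjugating by the full lift of
      -- `b`.
      have h1 := hr' (Subgroup.centralizer {prodTof hc v fun _ => a}) fun q' b' hq hq' => by
        rw [Subgroup.mem_centralizer_singleton_iff]
        exact (commute_prodTof hc a (fun h => hq (PCIndex.ext_of_mem hq' h hv)) b').eq.symm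
      rw [Subgroup.mem_centralizer_singleton_iff] at h1
      rw [hr, mul_inv_rev, mul_assoc (tof Γ G q b) r, h1]
      group
    · rw [partialConj_of_notMem b hv, innerTilde_of, mul_inv_eq_iff_eq_mul]
      exact (commute_prodTof hc a hv b).eq.symm

theorem innerTilde_range_normal (hΓ : ¬ HasSIL Γ) (hc : ∀ v (a b : G v), Commute a b) :
    (innerTilde hc : GraphProduct Γ G →* TildeProd Γ G).range.Normal := by
  refine ⟨?_⟩
  rintro _ ⟨x, rfl⟩ g
  exact ⟨_, (conj_innerTilde hΓ hc g x).symm⟩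

/-- Modulo the image, `p_{v,C}` is the inverse of the product of the other `p_{v,C'}`. If it does
not commute with `p_{w,D}`, then `w ∈ C`, so `w` lies in no `C'` and that product does commute.
Hence the quotient is abelian. -/
theorem commutator_le_innerTilde_range (hΓ : ¬ HasSIL Γ) (hc : ∀ v (a b : G v), Commute a b) :
    commutator (TildeProd Γ G) ≤
      (innerTilde hc : GraphProduct Γ G →* TildeProd Γ G).range := by
  have := innerTilde_range_normal hΓ hc
  set N := (innerTilde hc : GraphProduct Γ G →* TildeProd Γ G).range
  have hgen : ∀ (p : PCIndex Γ) (a : G p.1) (q : PCIndex Γ) (b : G q.1),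
      Commute (QuotientGroup.mk' N (tof Γ G p a)) (QuotientGroup.mk' N (tof Γ G q b)) := by
    intro p a q b
    by_cases h : p.1 ∈ q.verts ∧ q.1 ∈ p.verts
    · obtain ⟨r, hr, hr'⟩ := exists_prodTof_eq hc p a
      have h1 := hr' (Subgroup.centralizer {tof Γ G q b}) fun q' b' hq hq' => by
        rw [Subgroup.mem_centralizer_singleton_iff]
        exact (commute_tof hc (fun h' => hq (PCIndex.ext_of_mem hq' h'.2 h.2)) b' b).eq
      rw [Subgroup.mem_centralizer_singleton_iff] at h1
      have h2 : QuotientGroup.mk' N (tof Γ G p a * r) = 1 := by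
        rw [QuotientGroup.mk'_apply, QuotientGroup.eq_one_iff, ← hr, ← innerTilde_of]
        exact ⟨_, rfl⟩
      rw [map_mul] at h2
      rw [eq_inv_of_mul_eq_one_left h2]
      exact ((show Commute r (tof Γ G q b) from h1).map (QuotientGroup.mk' N)).inv_left
    · exact (commute_tof hc h a b).map _
  have hall : ∀ x y : TildeProd Γ G, Commute (QuotientGroup.mk' N x) (QuotientGroup.mk' N y) := by
    intro x y
    induction x using TildeProd.induction_of with
    | one => rw [map_one]; exact Commute.one_left _
    | mul u w hu hw => rw [map_mul]; exact hu.mul_left hw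
    | of p a =>
      induction y using TildeProd.induction_of with
      | one => rw [map_one]; exact Commute.one_right _
      | mul u w hu hw => rw [map_mul]; exact hu.mul_right hw
      | of q b => exact hgen p a q b
  rw [commutator_def, Subgroup.commutator_le]
  intro x _ y _
  rw [← QuotientGroup.eq_one_iff, ← QuotientGroup.mk'_apply, map_commutatorElement,
    commutatorElement_eq_one_iff_commute]
  exact hall x y

/-- Elements that commute with all vertex groups have trivial image under `innerTilde`. -/
theorem innerTilde_eq_one (hc : ∀ v (a b : G v), Commute a b) [∀ v, Nontrivial (G v)]
    {x : GraphProduct Γ G} (hx : ∀ u a, Commute x (of Γ G u a)) : innerTilde hc x = 1 := by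
  classical
  have := Fintype.ofFinite V
  -- The centralizer lemma puts `x` in every `G_{st(u)}`; the retractions are intersected one star
  -- at a time, starting from the whole vertex set.
  have hs : ∀ s : Finset V, retract Γ G {w | ∀ u ∈ s, w ∈ star Γ u} x = x := by
    intro s
    induction s using Finset.induction_on with
    | empty =>
      refine DFunLike.congr_fun (f := retract Γ G _) (g := MonoidHom.id _) (hom_ext fun v a => ?_) x
      exact retract_of_mem (by simp) a
    | insert u s _ ih =>
      obtain ⟨a, ha⟩ := exists_ne (1 : G u)
      have h1 := retract_eq_self (mem_subgroupOn_star_of_commute ha (hx u a))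
      have h2 := retract_retract (Γ := Γ) (G := G) (star Γ u) {w | ∀ u ∈ s, w ∈ star Γ u} x
      rw [ih, h1] at h2
      rw [show {w | ∀ u' ∈ insert u s, w ∈ star Γ u'} =
        star Γ u ∩ {w | ∀ u ∈ s, w ∈ star Γ u} from ?_]
      · exact h2.symm
      · ext w; simp
  have h := hs Finset.univ
  rw [← h]
  refine DFunLike.congr_fun (f := (innerTilde hc).comp (retract Γ G _))
    (g := (1 : GraphProduct Γ G →* TildeProd Γ G)) (hom_ext fun v a => ?_) x
  rw [MonoidHom.comp_apply]
  by_cases hv : v ∈ {w | ∀ u ∈ (Finset.univ : Finset V), w ∈ star Γ u}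
  · rw [retract_of_mem hv, innerTilde_of]
    -- A vertex in every star is adjacent to all others, so `Γ ∖ st(v)` has no component and the
    -- product is empty.
    refine Subgroup.mem_bot.1 (prodTof_mem hc fun C => ?_)
    obtain ⟨u, hu⟩ := PCIndex.verts_nonempty ⟨v, C⟩
    exact absurd (hv u (Finset.mem_univ u)) (notMem_star_symm (PCIndex.not_mem_star hu))
  · rw [retract_of_notMem hv, map_one]; rfl

/-- Without separating intersections of links, the partial conjugations satisfy no relations but
those of the graph product over `Γ̃`. -/
theorem toAut_injective (hΓ : ¬ HasSIL Γ) (hc : ∀ v (a b : G v), Commute a b)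
    [∀ v, Nontrivial (G v)] : Function.Injective (toAut (Γ := Γ) hΓ hc) := by
  rw [injective_iff_map_eq_one]
  intro g hg
  have h1 : toPi (tildeGraph Γ) (fun p : PCIndex Γ => G p.1) g = 1 := by
    funext p
    obtain ⟨u, hu⟩ := p.verts_nonempty
    obtain ⟨h, hh, hh'⟩ := exists_toAut_of_eq hΓ hc g u
    obtain ⟨a, ha⟩ := exists_ne (1 : G u)
    rw [← hh' p hu, Pi.one_apply]
    -- As `g` acts trivially, the conjugator `h` centralizes `a` and is supported on `st(u)`,
    -- whereas `p.1 ∉ st(u)`.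
    refine toPi_eq_one_of_mem_subgroupOn (mem_subgroupOn_star_of_commute ha (x := h) ?_)
      (notMem_star_symm (PCIndex.not_mem_star hu))
    have := hh a
    rw [hg, MulAut.one_apply, eq_mul_inv_iff_mul_eq] at this
    exact this.symm
  obtain ⟨x, rfl⟩ := commutator_le_innerTilde_range hΓ hc (mem_commutator_of_toPi_eq_one h1)
  refine innerTilde_eq_one hc fun u a => ?_
  rw [toAut_innerTilde] at hg
  have := DFunLike.congr_fun hg (of Γ G u a)
  rw [MulAut.conj_apply, MulAut.one_apply, mul_inv_eq_iff_eq_mul] at this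
  exact this

end Inner

/-! ### Automorphisms that permute the vertex groups -/

section Monomial

variable {V : Type*} {Γ : SimpleGraph V} {G : V → Type*} [∀ v, Group (G v)]

/-- The automorphism `f` permutes the vertex groups according to the symmetry `τ` of the graph. -/
def IsMonomial (f : MulAut (GraphProduct Γ G)) (τ : Γ ≃g Γ) : Prop :=
  ∀ v, (of Γ G v).range.map f.toMonoidHom = (of Γ G (τ v)).range

theorem IsMonomial.exists_apply_eq {f : MulAut (GraphProduct Γ G)} {τ : Γ ≃g Γ}
    (h : IsMonomial f τ) (v : V) (a : G v) : ∃ b, f (of Γ G v a) = of Γ G (τ v) b := by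
  have : f (of Γ G v a) ∈ (of Γ G (τ v)).range := by
    rw [← h v]
    exact ⟨_, ⟨a, rfl⟩, rfl⟩
  obtain ⟨b, hb⟩ := this
  exact ⟨b, hb.symm⟩

theorem IsMonomial.exists_eq_apply {f : MulAut (GraphProduct Γ G)} {τ : Γ ≃g Γ}
    (h : IsMonomial f τ) (v : V) (b : G (τ v)) : ∃ a, f (of Γ G v a) = of Γ G (τ v) b := by
  have : of Γ G (τ v) b ∈ (of Γ G v).range.map f.toMonoidHom := by
    rw [h v]
    exact ⟨b, rfl⟩
  obtain ⟨_, ⟨a, rfl⟩, ha⟩ := this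
  exact ⟨a, ha⟩

/-- The group of automorphisms that permute the vertex groups. -/
def monomialAut (Γ : SimpleGraph V) (G : V → Type*) [∀ v, Group (G v)] :
    Subgroup (MulAut (GraphProduct Γ G)) where
  carrier := {f | ∃ τ, IsMonomial f τ}
  one_mem' := ⟨1, fun _ => Subgroup.map_id _⟩
  mul_mem' := by
    rintro f g ⟨τ, hf⟩ ⟨σ, hg⟩
    refine ⟨τ * σ, fun v => ?_⟩
    change _ = (of Γ G (τ (σ v))).range
    rw [← hf, ← hg, Subgroup.map_map]
    rfl
  inv_mem' := by
    rintro f ⟨τ, hf⟩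
    refine ⟨τ⁻¹, fun v => ?_⟩
    have h := hf (τ⁻¹ v)
    rw [show τ (τ⁻¹ v) = v from τ.apply_symm_apply v] at h
    rw [← h, Subgroup.map_map]
    convert Subgroup.map_id _
    ext x
    exact f.symm_apply_apply x

/-- Such an automorphism is determined by a self-map of the finite set `Σ v, G v`. -/
theorem finite_monomialAut [Finite V] [∀ v, Finite (G v)] : Finite (monomialAut Γ G) := by
  have h : ∀ (f : monomialAut Γ G) (x : Σ v, G v), ∃ y : Σ v, G v,
      f.1 (of Γ G x.1 x.2) = of Γ G y.1 y.2 := by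
    rintro ⟨f, τ, hf⟩ ⟨v, a⟩
    obtain ⟨b, hb⟩ := hf.exists_apply_eq v a
    exact ⟨⟨_, b⟩, hb⟩
  choose F hF using h
  refine Finite.of_injective F fun f g hfg => Subtype.ext (mulAut_ext fun v a => ?_)
  rw [hF f ⟨v, a⟩, hF g ⟨v, a⟩, hfg]

/-- An element of a vertex group and its image both lie in vertex groups, where `toPi` determines
the element. This yields the trivial intersection with the partial conjugations. -/
theorem eq_one_of_mem_monomialAut {f : MulAut (GraphProduct Γ G)} (hf : f ∈ monomialAut Γ G)
    (h : ∀ x, toPi Γ G (f x) = toPi Γ G x) : f = 1 := by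
  obtain ⟨τ, hf⟩ := hf
  apply mulAut_ext
  intro v a
  obtain ⟨b, hb⟩ := hf.exists_apply_eq v a
  rw [hb, MulAut.one_apply]
  exact of_eq_of_toPi_eq (by rw [← hb, h])

theorem mapsTo_compl_star (τ : Γ ≃g Γ) (v : V) :
    Set.MapsTo τ.toHom (star Γ v)ᶜ (star Γ (τ v))ᶜ := by
  intro u hu
  change u ∉ star Γ v at hu
  change τ u ∉ star Γ (τ v)
  rw [notMem_star_iff] at hu ⊢
  exact ⟨fun h => hu.1 (τ.injective h), fun h => hu.2 (τ.map_adj_iff.1 h)⟩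

/-- The action of the symmetries of `Γ` on the vertices of `Γ̃`. -/
def PCIndex.map (τ : Γ ≃g Γ) (p : PCIndex Γ) : PCIndex Γ :=
  ⟨τ p.1, p.2.map (SimpleGraph.induceHom τ.toHom (mapsTo_compl_star τ p.1))⟩

theorem PCIndex.mem_map {τ : Γ ≃g Γ} {p : PCIndex Γ} {u : V} (hu : u ∈ p.verts) :
    τ u ∈ (p.map τ).verts := by
  obtain ⟨u, hu, rfl⟩ := hu
  rw [SimpleGraph.ConnectedComponent.mem_supp_iff] at hu
  refine ⟨SimpleGraph.induceHom τ.toHom (mapsTo_compl_star τ p.1) u, ?_, rfl⟩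
  exact congrArg (SimpleGraph.ConnectedComponent.map
    (SimpleGraph.induceHom τ.toHom (mapsTo_compl_star τ p.1))) hu

/-- Stated for a pair `τ`, `σ` rather than `τ` and its inverse, so that it serves both sides of the
bijection in `tildeIso`. -/
theorem PCIndex.map_symm_map (τ σ : Γ ≃g Γ) (h : ∀ v, σ (τ v) = v) (p : PCIndex Γ) :
    (p.map τ).map σ = p := by
  obtain ⟨u, hu⟩ := p.verts_nonempty
  refine PCIndex.ext_of_mem (h _) (u := u) ?_ hu
  have := PCIndex.mem_map (τ := σ) (PCIndex.mem_map (τ := τ) hu)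
  rwa [h] at this

theorem PCIndex.mem_map_iff {τ : Γ ≃g Γ} {p : PCIndex Γ} {u : V} :
    τ u ∈ (p.map τ).verts ↔ u ∈ p.verts := by
  refine ⟨fun h => ?_, PCIndex.mem_map⟩
  have := PCIndex.mem_map (τ := τ.symm) h
  rwa [PCIndex.map_symm_map _ _ τ.symm_apply_apply, show τ.symm (τ u) = u from
    τ.symm_apply_apply u] at this

/-- The symmetry of `Γ̃` induced by a symmetry of `Γ`. -/
def tildeIso (τ : Γ ≃g Γ) : tildeGraph Γ ≃g tildeGraph Γ where
  toFun := PCIndex.map τ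
  invFun := PCIndex.map τ.symm
  left_inv := PCIndex.map_symm_map _ _ τ.symm_apply_apply
  right_inv := PCIndex.map_symm_map _ _ τ.apply_symm_apply
  map_rel_iff' := by
    intro p q
    change (tildeGraph Γ).Adj (p.map τ) (q.map τ) ↔ _
    rw [tildeGraph_adj_iff, tildeGraph_adj_iff]
    refine and_congr (not_congr ⟨fun h => ?_, fun h => h ▸ rfl⟩)
      (not_congr (and_congr PCIndex.mem_map_iff PCIndex.mem_map_iff))
    rw [← PCIndex.map_symm_map _ _ τ.symm_apply_apply p, h,
      PCIndex.map_symm_map _ _ τ.symm_apply_apply]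

theorem IsMonomial.conj_partialConj {f : MulAut (GraphProduct Γ G)} {τ : Γ ≃g Γ}
    (hf : IsMonomial f τ) {p : PCIndex Γ} {a : G p.1} {b : G (τ p.1)}
    (hab : f (of Γ G p.1 a) = of Γ G (τ p.1) b) :
    f * partialConj Γ G p a * f⁻¹ = partialConj Γ G (p.map τ) b := by
  apply mulAut_ext
  intro u x
  obtain ⟨u, rfl⟩ := τ.surjective u
  obtain ⟨y, hy⟩ := hf.exists_eq_apply u x
  have hy' : f⁻¹ (of Γ G (τ u) x) = of Γ G u y := by
    rw [← hy]
    exact f.symm_apply_apply _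
  rw [MulAut.mul_apply, MulAut.mul_apply, hy']
  by_cases hu : u ∈ p.verts
  · rw [partialConj_of_mem a hu, partialConj_of_mem (p := p.map τ) b (PCIndex.mem_map hu), map_mul,
      map_mul, map_inv, hab, hy]
    rfl
  · rw [partialConj_of_notMem a hu,
      partialConj_of_notMem (p := p.map τ) b (mt PCIndex.mem_map_iff.1 hu), hy]

variable (hΓ : ¬ HasSIL Γ) (hc : ∀ v (a b : G v), Commute a b)

theorem IsMonomial.conj_toAut_tof {f : MulAut (GraphProduct Γ G)} {τ : Γ ≃g Γ}
    (hf : IsMonomial f τ) {p : PCIndex Γ} {a : G p.1} {b : G (τ p.1)}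
    (hab : f (of Γ G p.1 a) = of Γ G (τ p.1) b) :
    f * toAut hΓ hc (tof Γ G p a) * f⁻¹ = toAut hΓ hc (tof Γ G (p.map τ) b) := by
  rw [toAut_tof, hf.conj_partialConj hab]
  exact (toAut_tof hΓ hc (p.map τ) b).symm

theorem exists_conj_toAut {f : MulAut (GraphProduct Γ G)} (hf : f ∈ monomialAut Γ G)
    (g : TildeProd Γ G) : ∃ g', f * toAut hΓ hc g * f⁻¹ = toAut hΓ hc g' := by
  obtain ⟨τ, hf⟩ := hf
  induction g using TildeProd.induction_of with
  | one => exact ⟨1, by simp⟩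
  | mul g₁ g₂ h₁ h₂ =>
    obtain ⟨k₁, hk₁⟩ := h₁
    obtain ⟨k₂, hk₂⟩ := h₂
    refine ⟨k₁ * k₂, ?_⟩
    rw [map_mul, map_mul, ← hk₁, ← hk₂]
    group
  | of p a =>
    obtain ⟨b, hb⟩ := hf.exists_apply_eq p.1 a
    exact ⟨_, hf.conj_toAut_tof hΓ hc hb⟩

theorem monomialAut_le_normalizer :
    monomialAut Γ G ≤ Subgroup.normalizer ((toAut hΓ hc).range : Set (MulAut _)) := by
  intro f hf
  rw [Subgroup.mem_normalizer_iff]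
  intro g
  constructor
  · rintro ⟨x, rfl⟩
    obtain ⟨y, hy⟩ := exists_conj_toAut hΓ hc hf x
    exact ⟨y, hy.symm⟩
  · rintro ⟨x, hx⟩
    obtain ⟨y, hy⟩ := exists_conj_toAut hΓ hc (inv_mem hf) x
    refine ⟨y, ?_⟩
    rw [← hy, hx]
    group

theorem eq_one_of_toAut_mem_monomialAut {g : TildeProd Γ G}
    (hg : toAut hΓ hc g ∈ monomialAut Γ G) : toAut hΓ hc g = 1 :=
  eq_one_of_mem_monomialAut hg (toPi_toAut hΓ hc g)

end Monomial

/-! ### Graph products of cyclic groups -/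

section Cyclic

variable {V : Type*} {Γ : SimpleGraph V} {n : V → ℕ}

theorem cyc_commute (v : V) (a b : Cyc n v) : Commute a b := mul_comm a b

theorem exists_zpow_eq {v : V} (a : Cyc n v) : ∃ k : ℤ, a = Multiplicative.ofAdd 1 ^ k := by
  obtain ⟨k, hk⟩ := ZMod.intCast_surjective a.toAdd
  refine ⟨k, ?_⟩
  rw [← ofAdd_zsmul, zsmul_one, hk]
  rfl

theorem range_of_eq_zpowers (v : V) :
    (of Γ (Cyc n) v).range = Subgroup.zpowers (gen Γ n v) := by
  ext x
  rw [MonoidHom.mem_range, Subgroup.mem_zpowers_iff]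
  constructor
  · rintro ⟨a, rfl⟩
    obtain ⟨k, rfl⟩ := exists_zpow_eq a
    exact ⟨k, (map_zpow _ _ _).symm⟩
  · rintro ⟨k, rfl⟩
    exact ⟨_, map_zpow _ _ _⟩

theorem sigma_le_monomialAut : sigma Γ n ≤ monomialAut Γ (Cyc n) := by
  rw [sigma, Subgroup.closure_le]
  rintro f (⟨τ, hτ⟩ | ⟨v, α, hv, hu⟩)
  · refine ⟨τ, fun v => ?_⟩
    rw [range_of_eq_zpowers, range_of_eq_zpowers, MonoidHom.map_zpowers, ← hτ]
    rfl
  · refine ⟨1, fun u => ?_⟩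
    change _ = (of Γ (Cyc n) u).range
    ext x
    rw [Subgroup.mem_map]
    by_cases huv : u = v
    · subst huv
      constructor
      · rintro ⟨_, ⟨a, rfl⟩, rfl⟩
        exact ⟨α a, (hv a).symm⟩
      · rintro ⟨a, rfl⟩
        refine ⟨_, ⟨α.symm a, rfl⟩, (hv _).trans ?_⟩
        rw [MulEquiv.apply_symm_apply]
    · constructor
      · rintro ⟨_, ⟨a, rfl⟩, rfl⟩
        exact ⟨a, (hu u huv a).symm⟩
      · rintro ⟨a, rfl⟩
        exact ⟨_, ⟨a, rfl⟩, hu u huv a⟩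

theorem range_toAut_eq_autPC (hΓ : ¬ HasSIL Γ) :
    (toAut hΓ (cyc_commute (n := n))).range = autPC Γ n := by
  apply le_antisymm
  · rintro _ ⟨g, rfl⟩
    induction g using TildeProd.induction_of with
    | one => rw [map_one]; exact one_mem _
    | mul g h hg hh => rw [map_mul]; exact mul_mem hg hh
    | of p a =>
      obtain ⟨k, rfl⟩ := exists_zpow_eq a
      rw [map_zpow, map_zpow]
      refine zpow_mem ?_ k
      rw [toAut_tof]
      exact Subgroup.subset_closure ⟨p, rfl⟩
  · rw [autPC, Subgroup.closure_le]
    rintro _ ⟨p, rfl⟩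
    exact ⟨tof Γ (Cyc n) p (Multiplicative.ofAdd 1), toAut_tof hΓ cyc_commute p _⟩

end Cyclic

/-! ### Isometries of the cubical complex -/

section Cellular

variable {V : Type*} {Γ : SimpleGraph V} {G : V → Type*} [∀ v, Group (G v)]

/-- The permutation `θ` of the graph product permutes the cosets of the vertex groups
according to the symmetry `τ` of the graph. -/
def IsCellular (θ : Equiv.Perm (GraphProduct Γ G)) (τ : Γ ≃g Γ) : Prop :=
  ∀ v x y, x⁻¹ * y ∈ (of Γ G v).range ↔ (θ x)⁻¹ * θ y ∈ (of Γ G (τ v)).range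

theorem IsCellular.inv {θ : Equiv.Perm (GraphProduct Γ G)} {τ : Γ ≃g Γ} (h : IsCellular θ τ) :
    IsCellular θ⁻¹ τ⁻¹ := by
  intro v x y
  rw [h (τ⁻¹ v) (θ⁻¹ x) (θ⁻¹ y), show τ (τ⁻¹ v) = v from τ.apply_symm_apply v,
    show θ (θ⁻¹ x) = x from θ.apply_symm_apply x, show θ (θ⁻¹ y) = y from θ.apply_symm_apply y]

/-- The group of permutations of the graph product that permute the cosets of the vertex groups
according to a symmetry of the graph. -/
def cellular (Γ : SimpleGraph V) (G : V → Type*) [∀ v, Group (G v)] :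
    Subgroup (Equiv.Perm (GraphProduct Γ G)) where
  carrier := {θ | ∃ τ, IsCellular θ τ}
  one_mem' := ⟨1, fun _ _ _ => Iff.rfl⟩
  mul_mem' := by
    rintro θ η ⟨τ, hθ⟩ ⟨σ, hη⟩
    exact ⟨τ * σ, fun v x y => (hη v x y).trans (hθ (σ v) (η x) (η y))⟩
  inv_mem' := by
    rintro θ ⟨τ, hθ⟩
    exact ⟨τ⁻¹, hθ.inv⟩

/-- A word in the vertex groups of `T` is a path from `x` whose steps stay in cosets of these
groups; `θ` maps each step to one of type `τ v`. The starting point must vary in the induction. -/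
theorem IsCellular.mem_subgroupOn {θ : Equiv.Perm (GraphProduct Γ G)} {τ : Γ ≃g Γ}
    (h : IsCellular θ τ) {T : Set V} {x y : GraphProduct Γ G}
    (hxy : x⁻¹ * y ∈ subgroupOn Γ G T) : (θ x)⁻¹ * θ y ∈ subgroupOn Γ G (τ '' T) := by
  obtain ⟨z, rfl⟩ : ∃ z, y = x * z := ⟨x⁻¹ * y, by group⟩
  rw [inv_mul_cancel_left] at hxy
  induction hxy using Subgroup.iSup_induction' generalizing x with
  | h1 => simp
  | hmul z w _ _ hz hw =>
    have := mul_mem (hz (x := x)) (hw (x := x * z))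
    rwa [← mul_assoc, mul_assoc, mul_assoc, mul_inv_cancel_left, mul_assoc] at this
  | hp v z hz =>
    by_cases hv : v ∈ T
    · simp only [hv, iSup_pos] at hz
      have h1 := (h v x (x * z)).1 (by rwa [inv_mul_cancel_left])
      obtain ⟨b, hb⟩ := h1
      rw [← hb]
      exact of_mem_subgroupOn (Set.mem_image_of_mem τ hv) b
    · simp only [hv, iSup_neg, Subgroup.mem_bot, not_false_eq_true] at hz
      subst hz
      simp

theorem IsCellular.mem_subgroupOn_iff {θ : Equiv.Perm (GraphProduct Γ G)} {τ : Γ ≃g Γ}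
    (h : IsCellular θ τ) {T : Set V} {x y : GraphProduct Γ G} :
    (θ x)⁻¹ * θ y ∈ subgroupOn Γ G (τ '' T) ↔ x⁻¹ * y ∈ subgroupOn Γ G T := by
  refine ⟨fun hxy => ?_, h.mem_subgroupOn⟩
  have h1 := h.inv.mem_subgroupOn hxy
  rw [show θ⁻¹ (θ x) = x from θ.symm_apply_apply x, show θ⁻¹ (θ y) = y from θ.symm_apply_apply y,
    ← Set.image_comp] at h1
  convert h1
  ext v
  rw [Set.mem_image]
  constructor
  · intro hv
    exact ⟨v, hv, τ.symm_apply_apply v⟩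
  · rintro ⟨w, hw, rfl⟩
    rwa [show (⇑τ⁻¹ ∘ ⇑τ) w = w from τ.symm_apply_apply w]

theorem mem_smul_subgroupOn {g x : GraphProduct Γ G} {T : Set V} :
    x ∈ g • (subgroupOn Γ G T : Set (GraphProduct Γ G)) ↔ g⁻¹ * x ∈ subgroupOn Γ G T := by
  rw [Set.mem_smul_set_iff_inv_smul_mem, smul_eq_mul, SetLike.mem_coe]

theorem IsCellular.image_smul {θ : Equiv.Perm (GraphProduct Γ G)} {τ : Γ ≃g Γ}
    (h : IsCellular θ τ) (g : GraphProduct Γ G) (T : Set V) :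
    θ '' (g • (subgroupOn Γ G T : Set (GraphProduct Γ G))) =
      θ g • (subgroupOn Γ G (τ '' T) : Set (GraphProduct Γ G)) := by
  ext x
  obtain ⟨x, rfl⟩ := θ.surjective x
  rw [θ.injective.mem_set_image, mem_smul_subgroupOn, mem_smul_subgroupOn, h.mem_subgroupOn_iff]

instance : MulAction (cellular Γ G) (CliqueCoset Γ G) where
  smul θ S := ⟨θ.1 '' S.1, by
    obtain ⟨θ, τ, h⟩ := θ
    obtain ⟨g, T, hT, hS⟩ := S.2
    refine ⟨θ g, τ '' T, ?_, by rw [hS, h.image_smul]⟩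
    rintro _ ⟨v, hv, rfl⟩ _ ⟨w, hw, rfl⟩ hne
    exact τ.map_adj_iff.2 (hT hv hw fun h => hne (h ▸ rfl))⟩
  one_smul S := Subtype.ext (Set.image_id S.1)
  mul_smul θ η S := Subtype.ext (Set.image_comp θ.1 η.1 S.1)

theorem cellular_smul_val (θ : cellular Γ G) (S : CliqueCoset Γ G) : (θ • S).1 = θ.1 '' S.1 := rfl

theorem cellular_smul_le {θ : cellular Γ G} {S S' : CliqueCoset Γ G} (h : S ≤ S') :
    θ • S ≤ θ • S' :=
  Set.image_mono (f := θ.1) (show S.1 ⊆ S'.1 from h)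

/-- The type can be read off from which cosets of vertex groups through a point lie in `S`, and `θ`
permutes these cosets. -/
theorem IsCellular.type_smul {θ : cellular Γ G} {τ : Γ ≃g Γ} (h : IsCellular θ.1 τ)
    (S : CliqueCoset Γ G) (v : V) : τ v ∈ (θ • S).type ↔ v ∈ S.type := by
  obtain ⟨s, hs⟩ := S.nonempty
  have key : ∀ (S : CliqueCoset Γ G) s, s ∈ S.1 → ∀ v, (v ∈ S.type ↔
      ∀ x, s⁻¹ * x ∈ (of Γ G v).range → x ∈ S.1) := by
    intro S s hs v
    rw [CliqueCoset.mem_type_iff hs]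
    refine ⟨fun h x hx => ?_, fun h a => h _ ⟨a, by group⟩⟩
    obtain ⟨a, ha⟩ := hx
    have := h a
    rwa [ha, mul_inv_cancel_left] at this
  rw [key S s hs, key (θ • S) (θ.1 s) ⟨s, hs, rfl⟩, θ.1.surjective.forall]
  refine forall_congr' fun x => ?_
  rw [← h v s x, cellular_smul_val, θ.1.injective.mem_set_image]

instance : MulAction (cellular Γ G) (Complex Γ G) where
  smul g x :=
    { weight := x.weight.equivMapDomain (MulAction.toPerm g)
      nonneg := fun S => x.nonneg _
      sum_eq_one := by
        rw [Finsupp.equivMapDomain_eq_mapDomain, Finsupp.sum_mapDomain_index (fun _ => rfl)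
          (fun _ _ _ => rfl)]
        exact x.sum_eq_one
      chain := by
        intro S hS S' hS' hne
        simp only [Finset.mem_coe, Finsupp.mem_support_iff, Finsupp.equivMapDomain_apply] at hS hS'
        have := x.chain (Finsupp.mem_support_iff.2 hS) (Finsupp.mem_support_iff.2 hS')
          (fun h => hne ((MulAction.toPerm g).symm.injective h))
        refine this.imp (fun h => ?_) (fun h => ?_) <;>
          simpa using cellular_smul_le (θ := g) h }
  one_smul x := by
    apply Complex.ext; ext S
    exact congrArg x.weight (show (1 : cellular Γ G)⁻¹ • S = S by rw [inv_one, one_smul])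
  mul_smul g h x := by
    apply Complex.ext; ext S
    exact congrArg x.weight (show (g * h)⁻¹ • S = h⁻¹ • g⁻¹ • S by rw [mul_inv_rev, mul_smul])

namespace Complex

theorem cellular_smul_weight (θ : cellular Γ G) (x : Complex Γ G) (S : CliqueCoset Γ G) :
    (θ • x).weight S = x.weight (θ⁻¹ • S) := rfl

theorem cellular_smul_weight_eq (θ : cellular Γ G) (x : Complex Γ G) :
    (θ • x).weight = x.weight.mapDomain (θ • ·) :=
  Finsupp.equivMapDomain_eq_mapDomain (MulAction.toPerm θ) x.weight

theorem coord_cellular_smul {θ : cellular Γ G} {τ : Γ ≃g Γ} (h : IsCellular θ.1 τ)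
    (x : Complex Γ G) (v : V) : (θ • x).coord (τ v) = x.coord v := by
  rw [coord, cellular_smul_weight_eq, Finsupp.sum_mapDomain_index_inj (MulAction.injective θ),
    coord]
  refine Finset.sum_congr rfl fun S _ => ?_
  dsimp only
  by_cases hv : v ∈ S.type
  · rw [Set.indicator_of_mem hv, Set.indicator_of_mem ((h.type_smul S v).2 hv)]
  · rw [Set.indicator_of_notMem hv, Set.indicator_of_notMem (mt (h.type_smul S v).1 hv)]

theorem cubeDist_cellular_smul (θ : cellular Γ G) (x y : Complex Γ G) :
    cubeDist (θ • x) (θ • y) = cubeDist x y := by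
  obtain ⟨τ, h⟩ := θ.2
  rw [cubeDist, cubeDist, ← finsum_comp_equiv τ.toEquiv]
  congr 1
  refine finsum_congr fun v => ?_
  change ((θ • x).coord (τ v) - (θ • y).coord (τ v)) ^ 2 = _
  rw [coord_cellular_smul h, coord_cellular_smul h]

theorem mem_support_cellular_smul {θ : cellular Γ G} {x : Complex Γ G} {S : CliqueCoset Γ G}
    (hS : S ∈ (θ • x).weight.support) : ∃ S' ∈ x.weight.support, S = θ • S' :=
  ⟨θ⁻¹ • S, by rwa [Finsupp.mem_support_iff] at hS ⊢, (smul_inv_smul θ S).symm⟩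

theorem InCommonCube.cellular_smul {x y : Complex Γ G} (h : InCommonCube x y)
    (θ : cellular Γ G) : InCommonCube (θ • x) (θ • y) := by
  obtain ⟨A, B, hx, hy⟩ := h
  refine ⟨θ • A, θ • B, fun S hS => ?_, fun S hS => ?_⟩
  · obtain ⟨S', hS', rfl⟩ := mem_support_cellular_smul hS
    exact ⟨cellular_smul_le (hx S' hS').1, cellular_smul_le (hx S' hS').2⟩
  · obtain ⟨S', hS', rfl⟩ := mem_support_cellular_smul hS
    exact ⟨cellular_smul_le (hy S' hS').1, cellular_smul_le (hy S' hS').2⟩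

theorem HasString.cellular_smul {x y : Complex Γ G} {L : ℝ} (h : HasString x y L)
    (θ : cellular Γ G) : HasString (θ • x) (θ • y) L := by
  induction h with
  | refl x => exact .refl _
  | cons hc _ ih =>
    rw [← cubeDist_cellular_smul θ]
    exact .cons (hc.cellular_smul θ) ih

theorem dist_le_of_hasString [Finite V] {x y : Complex Γ G} {L : ℝ} (h : HasString x y L) :
    dist x y ≤ L :=
  csInf_le (bddBelow_string x y) h

theorem isometry_cellular_smul [Finite V] (θ : cellular Γ G) :
    Isometry fun x : Complex Γ G => θ • x := by
  refine Isometry.of_dist_eq fun x y => ?_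
  change sInf _ = sInf _
  congr 1
  ext L
  refine ⟨fun h => ?_, fun h => HasString.cellular_smul h θ⟩
  have := HasString.cellular_smul (G := G) h θ⁻¹
  rwa [inv_smul_smul, inv_smul_smul] at this

theorem weight_le_add_dist [Finite V] (x y : Complex Γ G) (S : CliqueCoset Γ G) :
    x.weight S ≤ y.weight S + 2 * dist x y := by
  refine le_of_forall_pos_lt_add fun ε hε => ?_
  obtain ⟨L, hL, hL'⟩ := Real.lt_sInf_add_pos (s := {L | HasString x y L}) (exists_string x y)
    (half_pos hε)
  have h' : sInf {L | HasString x y L} = dist x y := rfl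
  linarith [HasString.weight_le hL S]

end Complex

/-- The isometric action of the cellular permutations on the complex. -/
def cellularIsometry (Γ : SimpleGraph V) (G : V → Type*) [∀ v, Group (G v)] [Finite V] :
    cellular Γ G →* (Complex Γ G ≃ᵢ Complex Γ G) where
  toFun θ := ⟨MulAction.toPerm θ, Complex.isometry_cellular_smul θ⟩
  map_one' := IsometryEquiv.ext fun x => one_smul (cellular Γ G) x
  map_mul' θ η := IsometryEquiv.ext fun x => mul_smul θ η x

theorem cellularIsometry_apply [Finite V] (θ : cellular Γ G) (x : Complex Γ G) :
    cellularIsometry Γ G θ x = θ • x := rfl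

/-- The cosets of the trivial subgroup `G_∅` are singletons, so every element of the graph product
is a vertex of the complex. -/
theorem cellularIsometry_injective [Finite V] : Function.Injective (cellularIsometry Γ G) := by
  rw [injective_iff_map_eq_one]
  intro θ hθ
  refine Subtype.ext (Equiv.ext fun g => ?_)
  have h1 : θ • Complex.vertex (CliqueCoset.mk g ∅ (by simp)) =
      Complex.vertex (Γ := Γ) (G := G) (CliqueCoset.mk g ∅ (by simp)) :=
    DFunLike.congr_fun hθ _
  have h2 := congrArg (fun x => x.weight (CliqueCoset.mk g ∅ (by simp))) h1
  rw [Complex.cellular_smul_weight] at h2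
  simp only [Complex.vertex, Finsupp.single_eq_same] at h2
  have h3 : CliqueCoset.mk g ∅ (by simp) = θ⁻¹ • CliqueCoset.mk (Γ := Γ) (G := G) g ∅ (by simp) := by
    by_contra hne
    rw [Finsupp.single_eq_of_ne (Ne.symm hne)] at h2
    exact zero_ne_one h2
  have hval : (CliqueCoset.mk (Γ := Γ) (G := G) g ∅ (by simp)).1 = {g} := by
    ext x
    change x ∈ g • (subgroupOn Γ G ∅ : Set (GraphProduct Γ G)) ↔ _
    rw [mem_smul_subgroupOn]
    simp [subgroupOn, inv_mul_eq_one, eq_comm]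
  have h4 : (θ • CliqueCoset.mk (Γ := Γ) (G := G) g ∅ (by simp)).1 = _ :=
    congrArg (fun S : CliqueCoset Γ G => S.1) ((smul_eq_iff_eq_inv_smul θ).2 h3)
  rw [cellular_smul_val, hval, Set.image_singleton, Set.singleton_eq_singleton_iff] at h4
  exact h4

end Cellular

/-! ### Proper and cocompact actions on the complex -/

section Geometric

variable {V : Type*} {Γ : SimpleGraph V} {G : V → Type*} [∀ v, Group (G v)]

theorem finite_subgroupOn [Finite V] [∀ v, Finite (G v)] {T : Set V} (hT : Γ.IsClique T) :
    (subgroupOn Γ G T : Set (GraphProduct Γ G)).Finite := by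
  have := Fintype.ofFinite T
  have hcomm : Pairwise fun v w : T => ∀ (a : G v) (b : G w),
      Commute (of Γ G v.1 a) (of Γ G w.1 b) := fun v w hvw a b =>
    commute_of_of_adj Γ G (hT v.2 w.2 fun h => hvw (Subtype.ext h)) a b
  have h : subgroupOn Γ G T =
      (MonoidHom.noncommPiCoprod (fun v : T => of Γ G v.1) hcomm).range := by
    rw [MonoidHom.noncommPiCoprod_range, subgroupOn, iSup_subtype']
  rw [h, MonoidHom.coe_range]
  exact Set.finite_range _

theorem CliqueCoset.finite [Finite V] [∀ v, Finite (G v)] (S : CliqueCoset Γ G) : S.1.Finite := by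
  obtain ⟨g, T, hT, hS⟩ := S.2
  rw [hS]
  exact (finite_subgroupOn hT).image _

/-- A coset through `g` is determined by its type, a subset of the finite set `V`. -/
theorem CliqueCoset.finite_setOf_mem [Finite V] (g : GraphProduct Γ G) :
    {S : CliqueCoset Γ G | g ∈ S.1}.Finite := by
  refine Set.Finite.of_finite_image (Set.toFinite (CliqueCoset.type '' _)) ?_
  intro S hS S' hS' h
  refine Subtype.ext (Set.ext fun x => ?_)
  rw [CliqueCoset.mem_iff hS, CliqueCoset.mem_iff hS']
  rw [h]

namespace Complex

theorem support_nonempty (x : Complex Γ G) : x.weight.support.Nonempty := by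
  rw [Finset.nonempty_iff_ne_empty]
  intro h
  have := x.sum_eq
  rw [h, Finset.sum_empty] at this
  exact zero_ne_one this

theorem exists_ball_finite [Finite V] {H : Type*} [Group H] (κ : H →* cellular Γ G)
    (hκ : ∀ S : CliqueCoset Γ G, {h | κ h • S = S}.Finite) (x : Complex Γ G) :
    ∃ r > 0, {h : H | (cellularIsometry Γ G (κ h) '' Metric.ball x r ∩
      Metric.ball x r).Nonempty}.Finite := by
  obtain ⟨S, hS⟩ := x.support_nonempty
  have hpos : 0 < x.weight S :=
    lt_of_le_of_ne (x.nonneg S) (Ne.symm (Finsupp.mem_support_iff.1 hS))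
  -- If the ball meets its translate, then `x` is moved by less than half of its weight at `S`.
  -- Weights are 2-Lipschitz, so `h • x` still has positive weight at `S`; thus `h` carries one of
  -- the finitely many cosets in the support of `x` to `S`.
  refine ⟨x.weight S / 4, by positivity, ?_⟩
  refine Set.Finite.subset (s := ⋃ S' ∈ x.weight.support, {h | κ h • S' = S}) ?_ ?_
  · refine Set.Finite.biUnion (Finset.finite_toSet _) fun S' _ => ?_
    rcases Set.eq_empty_or_nonempty {h | κ h • S' = S} with h | ⟨h₀, h₀S⟩
    · rw [h]; exact Set.finite_empty
    -- The elements carrying `S'` to `S` form a coset of the stabilizer of `S'`.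
    · refine ((hκ S').image fun h => h₀ * h).subset fun h hh => ⟨h₀⁻¹ * h, ?_, by simp⟩
      change κ (h₀⁻¹ * h) • S' = S'
      rw [map_mul, mul_smul, show κ h • S' = S from hh, map_inv, inv_smul_eq_iff]
      exact h₀S.symm
  · rintro h ⟨_, ⟨y, hy, rfl⟩, hy'⟩
    rw [Metric.mem_ball] at hy hy'
    have h1 : dist x (κ h • x) < x.weight S / 2 := by
      have h2 : dist (cellularIsometry Γ G (κ h) y) (κ h • x) < x.weight S / 4 := by
        rw [← cellularIsometry_apply, IsometryEquiv.dist_eq]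
        exact hy
      have h3 := dist_triangle_left x (κ h • x) (cellularIsometry Γ G (κ h) y)
      linarith
    have h2 := weight_le_add_dist x (κ h • x) S
    have h3 : (κ h • x).weight S ≠ 0 := by
      intro h0
      linarith
    rw [cellular_smul_weight] at h3
    exact Set.mem_biUnion (Finsupp.mem_support_iff.2 h3) (smul_inv_smul (κ h) S)

/-- The points of the simplex spanned by a finite set of cosets. -/
def simplexWeights (c : Finset (CliqueCoset Γ G)) : Set (CliqueCoset Γ G → ℝ) :=
  {f | (∀ S, f S ∈ Set.Icc (0 : ℝ) 1) ∧ (∀ S ∉ c, f S = 0) ∧ ∑ S ∈ c, f S = 1}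

theorem isCompact_simplexWeights (c : Finset (CliqueCoset Γ G)) :
    IsCompact (simplexWeights c) := by
  have h : simplexWeights c = (⋂ S, {f | f S ∈ Set.Icc (0 : ℝ) 1}) ∩
      ((⋂ S ∉ c, {f | f S = 0}) ∩ {f | ∑ S ∈ c, f S = 1}) := by
    ext f
    simp [simplexWeights]
  refine (isCompact_univ_pi fun _ : CliqueCoset Γ G =>
    isCompact_Icc (a := (0 : ℝ)) (b := 1)).of_isClosed_subset ?_ fun f hf S _ => hf.1 S
  rw [h]
  refine (isClosed_iInter fun S => ?_).inter ((isClosed_biInter fun S _ => ?_).inter ?_)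
  · exact isClosed_Icc.preimage (continuous_apply S)
  · exact isClosed_eq (continuous_apply S) continuous_const
  · exact isClosed_eq (continuous_finsetSum _ fun S _ => continuous_apply S) continuous_const

/-- The point of a simplex with given barycentric coordinates. -/
def ofWeights {c : Finset (CliqueCoset Γ G)} (hc : IsChain (· ≤ ·) (c : Set (CliqueCoset Γ G)))
    (f : simplexWeights c) : Complex Γ G where
  weight := Finsupp.onFinset c f.1 fun S hS => by
    by_contra h
    exact hS (f.2.2.1 S h)
  nonneg S := (f.2.1 S).1
  sum_eq_one := by
    rw [Finsupp.onFinset_sum _ fun _ => rfl]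
    exact f.2.2.2
  chain := hc.mono (Finset.coe_subset.2 Finsupp.support_onFinset_subset)

theorem support_ofWeights_subset {c : Finset (CliqueCoset Γ G)}
    (hc : IsChain (· ≤ ·) (c : Set (CliqueCoset Γ G))) (f : simplexWeights c) :
    (ofWeights hc f).weight.support ⊆ c := by
  intro S hS
  by_contra h
  exact Finsupp.mem_support_iff.1 hS (f.2.2.1 S h)

theorem coord_ofWeights {c : Finset (CliqueCoset Γ G)}
    (hc : IsChain (· ≤ ·) (c : Set (CliqueCoset Γ G))) (f : simplexWeights c) (v : V) :
    (ofWeights hc f).coord v = ∑ S ∈ c, S.type.indicator (fun _ => f.1 S) v := by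
  rw [coord, Finsupp.sum_of_support_subset _ (support_ofWeights_subset hc f) _ (by simp)]
  rfl

theorem inCommonCube_ofWeights {c : Finset (CliqueCoset Γ G)}
    (hc : IsChain (· ≤ ·) (c : Set (CliqueCoset Γ G))) (f g : simplexWeights c) :
    InCommonCube (ofWeights hc f) (ofWeights hc g) := by
  have hne : c.Nonempty := (ofWeights hc f).support_nonempty.mono (support_ofWeights_subset hc f)
  obtain ⟨A, hA⟩ := Finset.exists_minimal hne
  obtain ⟨B, hB⟩ := Finset.exists_maximal hne
  have key : ∀ S ∈ c, A ≤ S ∧ S ≤ B := fun S hS =>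
    ⟨(hc.total hA.prop hS).elim id fun h => hA.le_of_le hS h,
      (hc.total hS hB.prop).elim id fun h => hB.le_of_ge hS h⟩
  exact ⟨A, B, fun S hS => key S (support_ofWeights_subset hc f hS),
    fun S hS => key S (support_ofWeights_subset hc g hS)⟩

/-- Two points of one simplex share a cube, so their distance is at most the Euclidean one, which is
continuous in the weights. -/
theorem continuous_ofWeights [Finite V] {c : Finset (CliqueCoset Γ G)}
    (hc : IsChain (· ≤ ·) (c : Set (CliqueCoset Γ G))) : Continuous (ofWeights hc) := by
  classical
  have := Fintype.ofFinite V
  rw [continuous_iff_continuousAt]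
  intro f₀
  rw [ContinuousAt, tendsto_iff_dist_tendsto_zero]
  have hle : ∀ f, dist (ofWeights hc f) (ofWeights hc f₀) ≤
      √ (∑ v, (∑ S ∈ c, S.type.indicator (fun _ => f.1 S) v -
        ∑ S ∈ c, S.type.indicator (fun _ => f₀.1 S) v) ^ 2) := by
    intro f
    refine (dist_le_of_hasString (.single (inCommonCube_ofWeights hc f f₀))).trans_eq ?_
    rw [cubeDist, finsum_eq_sum_of_fintype]
    simp only [coord_ofWeights]
  refine squeeze_zero (fun _ => dist_nonneg) hle ?_
  have hcont : Continuous fun f : simplexWeights c =>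
      √ (∑ v, (∑ S ∈ c, S.type.indicator (fun _ => f.1 S) v -
        ∑ S ∈ c, S.type.indicator (fun _ => f₀.1 S) v) ^ 2) := by
    refine Real.continuous_sqrt.comp (continuous_finsetSum _ fun v _ => ?_)
    refine ((continuous_finsetSum _ fun S _ => ?_).sub continuous_const).pow 2
    by_cases hv : v ∈ S.type
    · simp only [Set.indicator_of_mem hv]
      exact (continuous_apply S).comp continuous_subtype_val
    · simp only [Set.indicator_of_notMem hv]
      exact continuous_const
  have h := hcont.tendsto f₀
  simpa using h

/-- The graph product acts cocompactly on its complex. -/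
theorem exists_compact_cover [Finite V] (Γ : SimpleGraph V) (G : V → Type*)
    [∀ v, Group (G v)] :
    ∃ K : Set (Complex Γ G), IsCompact K ∧ ∀ x : Complex Γ G, ∃ g : GraphProduct Γ G,
      ∃ k ∈ K, g • k = x := by
  classical
  -- The compact set is the union of the simplices all of whose cosets contain `1`. A point is moved
  -- there by the inverse of an element of the smallest coset in its support.
  let E := (CliqueCoset.finite_setOf_mem (1 : GraphProduct Γ G)).toFinset
  let I := {c : Finset (CliqueCoset Γ G) // c ∈ E.powerset ∧
    IsChain (· ≤ ·) (c : Set (CliqueCoset Γ G))}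
  have : Finite I := Set.Finite.subset (Finset.finite_toSet E.powerset) fun c hc => hc.1
  refine ⟨⋃ c : I, Set.range (ofWeights c.2.2), isCompact_iUnion fun c => ?_, fun x => ?_⟩
  · have := isCompact_iff_compactSpace.1 (isCompact_simplexWeights c.1)
    exact isCompact_range (continuous_ofWeights c.2.2)
  · obtain ⟨A, hA⟩ := Finset.exists_minimal x.support_nonempty
    obtain ⟨g, hg⟩ := A.nonempty
    refine ⟨g, g⁻¹ • x, ?_, smul_inv_smul g x⟩
    set y := g⁻¹ • x
    have hy : y.weight.support ∈ E.powerset := by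
      rw [Finset.mem_powerset]
      intro S hS
      rw [Set.Finite.mem_toFinset]
      have h1 : x.weight (g • S) ≠ 0 := by
        have h2 : x.weight (g⁻¹⁻¹ • S) ≠ 0 := (Finsupp.mem_support_iff (f := y.weight)).1 hS
        rwa [inv_inv] at h2
      have h2 := Finsupp.mem_support_iff.2 h1
      have h3 : A ≤ g • S := (x.chain.total hA.prop h2).elim id fun h => hA.le_of_le h2 h
      obtain ⟨s, hs, hs'⟩ := h3 hg
      have : s = 1 := by simpa using hs'
      exact this ▸ hs
    have hmem : ∀ S, y.weight S ∈ Set.Icc (0 : ℝ) 1 := fun S => by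
      refine ⟨y.nonneg S, ?_⟩
      by_cases hS : S ∈ y.weight.support
      · rw [← y.sum_eq]
        exact Finset.single_le_sum (f := y.weight) (fun S _ => y.nonneg S) hS
      · rw [Finsupp.notMem_support_iff.1 hS]; exact zero_le_one
    refine Set.mem_iUnion.2 ⟨⟨y.weight.support, hy, y.chain⟩,
      ⟨y.weight, hmem, fun S hS => Finsupp.notMem_support_iff.1 hS, y.sum_eq⟩, ?_⟩
    apply Complex.ext
    ext S
    rfl

end Complex

end Geometric

/-! ### The action of the partial conjugations and the monomial automorphisms -/

section Action

variable {V : Type*} {Γ : SimpleGraph V} {G : V → Type*} [∀ v, Group (G v)]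

theorem of_eq_of_tof_eq {p q : PCIndex Γ} {a : G p.1} {b : G q.1}
    (h : tof Γ G p a = tof Γ G q b) : of Γ G p.1 a = of Γ G q.1 b := by
  by_cases hpq : p = q
  · subst hpq
    rw [of_injective (Γ := tildeGraph Γ) (G := fun p : PCIndex Γ => G p.1) p h]
  · have h1 := congrFun (congrArg (toPi (tildeGraph Γ) (fun p : PCIndex Γ => G p.1)) h) p
    have h2 := congrFun (congrArg (toPi (tildeGraph Γ) (fun p : PCIndex Γ => G p.1)) h) q
    rw [toPi_tof_same, toPi_tof_ne hpq] at h1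
    rw [toPi_tof_same, toPi_tof_ne (Ne.symm hpq)] at h2
    rw [h1, ← h2, map_one, map_one]

variable (hΓ : ¬ HasSIL Γ) (hc : ∀ v (a b : G v), Commute a b)

/-- The group generated by the partial conjugations and the automorphisms that permute the vertex
groups. -/
abbrev pcMonomial : Subgroup (MulAut (GraphProduct Γ G)) :=
  (toAut hΓ hc).range ⊔ monomialAut Γ G

theorem exists_eq_toAut_mul (h : pcMonomial hΓ hc) :
    ∃ g, ∃ s ∈ monomialAut Γ G, h.1 = toAut hΓ hc g * s := by
  have h1 : h.1 ∈ ((pcMonomial hΓ hc : Subgroup _) : Set (MulAut (GraphProduct Γ G))) := h.2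
  rw [Subgroup.coe_mul_of_right_le_normalizer_left _ _ (monomialAut_le_normalizer hΓ hc)] at h1
  obtain ⟨_, ⟨g, rfl⟩, s, hs, hgs⟩ := h1
  exact ⟨g, s, hs, hgs.symm⟩

/-- Every coset of the monomial group in the product of the two groups has a representative in the
image of `toAut`, since that image is normalized. -/
theorem exists_inv_mul_mem (h : pcMonomial hΓ hc) (x : TildeProd Γ G) :
    ∃ y, (toAut hΓ hc y)⁻¹ * h.1 * toAut hΓ hc x ∈ monomialAut Γ G := by
  obtain ⟨g, s, hs, hgs⟩ := exists_eq_toAut_mul hΓ hc h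
  obtain ⟨x', hx'⟩ := exists_conj_toAut hΓ hc hs x
  refine ⟨g * x', ?_⟩
  rw [hgs, map_mul, ← hx']
  convert hs using 1
  group

/-- The action on the graph product over `Γ̃`, which is identified with the cosets of the group of
monomial automorphisms. -/
def tildeAct (h : pcMonomial hΓ hc) (x : TildeProd Γ G) : TildeProd Γ G :=
  (exists_inv_mul_mem hΓ hc h x).choose

theorem tildeAct_spec (h : pcMonomial hΓ hc) (x : TildeProd Γ G) :
    (toAut hΓ hc (tildeAct hΓ hc h x))⁻¹ * h.1 * toAut hΓ hc x ∈ monomialAut Γ G :=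
  (exists_inv_mul_mem hΓ hc h x).choose_spec

variable [Finite V] [∀ v, Nontrivial (G v)]

/-- Representatives are unique: the two groups intersect trivially and `toAut` is injective. This
makes the chosen function an action. -/
theorem tildeAct_eq {h : pcMonomial hΓ hc} {x y : TildeProd Γ G}
    (hy : (toAut hΓ hc y)⁻¹ * h.1 * toAut hΓ hc x ∈ monomialAut Γ G) :
    tildeAct hΓ hc h x = y := by
  have h1 := mul_mem hy (inv_mem (tildeAct_spec hΓ hc h x))
  have h2 : toAut hΓ hc (y⁻¹ * tildeAct hΓ hc h x) ∈ monomialAut Γ G := by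
    convert h1 using 1
    rw [map_mul, map_inv]
    group
  have h3 := eq_one_of_toAut_mem_monomialAut hΓ hc h2
  rw [← map_one (toAut hΓ hc)] at h3
  exact (inv_mul_eq_one.1 (toAut_injective hΓ hc h3)).symm

/-- `tildeAct` as an action. -/
@[reducible]
def tildeMulAction : MulAction (pcMonomial hΓ hc) (TildeProd Γ G) where
  smul := tildeAct hΓ hc
  one_smul x := tildeAct_eq hΓ hc (by simp [one_mem])
  mul_smul h k x := tildeAct_eq hΓ hc <| by
    convert mul_mem (tildeAct_spec hΓ hc h (tildeAct hΓ hc k x)) (tildeAct_spec hΓ hc k x) using 1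
    rw [Subgroup.coe_mul]
    change (toAut hΓ hc (tildeAct hΓ hc h (tildeAct hΓ hc k x)))⁻¹ * _ * _ = _
    group

/-- `tildeAct` as a homomorphism to the permutations. -/
def tildePerm : pcMonomial hΓ hc →* Equiv.Perm (TildeProd Γ G) :=
  letI := tildeMulAction hΓ hc
  MulAction.toPermHom _ _

theorem tildePerm_apply (h : pcMonomial hΓ hc) (x : TildeProd Γ G) :
    tildePerm hΓ hc h x = tildeAct hΓ hc h x := rfl

theorem tildePerm_toAut (g x : TildeProd Γ G) (hg : toAut hΓ hc g ∈ pcMonomial hΓ hc) :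
    tildePerm hΓ hc ⟨toAut hΓ hc g, hg⟩ x = g * x := by
  refine tildeAct_eq hΓ hc ?_
  rw [map_mul]
  convert one_mem (monomialAut Γ G) using 1
  group

/-- Writing `h = g * s`, this is left multiplication by `g` after conjugation by `s`. -/
theorem toAut_tildePerm {h : pcMonomial hΓ hc} {g : TildeProd Γ G}
    {s : MulAut (GraphProduct Γ G)} (hs : s ∈ monomialAut Γ G) (hgs : h.1 = toAut hΓ hc g * s)
    (x : TildeProd Γ G) :
    toAut hΓ hc (tildePerm hΓ hc h x) = h.1 * toAut hΓ hc x * s⁻¹ := by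
  obtain ⟨x', hx'⟩ := exists_conj_toAut hΓ hc hs x
  have h1 : toAut hΓ hc (g * x') = h.1 * toAut hΓ hc x * s⁻¹ := by
    rw [map_mul, ← hx', hgs]
    group
  rw [tildePerm_apply, tildeAct_eq hΓ hc (y := g * x'), h1]
  rw [h1]
  convert hs using 1
  group

/-- The left factor cancels in `(h x)⁻¹ * (h y)`, leaving the conjugate of `x⁻¹ * y` by `s`;
conjugation by `s` carries the vertex group at `p` onto the one at `p.map τ`. -/
theorem isCellular_tildePerm (h : pcMonomial hΓ hc) : tildePerm hΓ hc h ∈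
    cellular (tildeGraph Γ) (fun p : PCIndex Γ => G p.1) := by
  obtain ⟨g, s, hs, hgs⟩ := exists_eq_toAut_mul hΓ hc h
  have ⟨τ, hτ⟩ := hs
  refine ⟨tildeIso τ, fun p x y => ?_⟩
  have key : toAut hΓ hc ((tildePerm hΓ hc h x)⁻¹ * tildePerm hΓ hc h y) =
      s * toAut hΓ hc (x⁻¹ * y) * s⁻¹ := by
    rw [map_mul, map_inv, toAut_tildePerm hΓ hc hs hgs, toAut_tildePerm hΓ hc hs hgs, map_mul,
      map_inv]
    group
  constructor
  · rintro ⟨a, ha⟩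
    obtain ⟨b, hb⟩ := hτ.exists_apply_eq p.1 a
    refine ⟨b, toAut_injective hΓ hc ?_⟩
    rw [key, ← ha]
    exact (hτ.conj_toAut_tof hΓ hc hb).symm
  · rintro ⟨b, hb⟩
    obtain ⟨a, ha⟩ := hτ.exists_eq_apply p.1 b
    refine ⟨a, toAut_injective hΓ hc ?_⟩
    have h1 := hτ.conj_toAut_tof hΓ hc ha
    have h2 : toAut hΓ hc (tof Γ G (p.map τ) b) = s * toAut hΓ hc (x⁻¹ * y) * s⁻¹ := by
      rw [← key, ← hb]
      rfl
    rw [← h1] at h2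
    exact mul_left_cancel (mul_right_cancel h2)

/-- The action by cellular permutations. -/
def tildeCellular : pcMonomial hΓ hc →* cellular (tildeGraph Γ) (fun p : PCIndex Γ => G p.1) :=
  (tildePerm hΓ hc).codRestrict _ (isCellular_tildePerm hΓ hc)

theorem tildeCellular_toAut_smul (g : TildeProd Γ G) (hg : toAut hΓ hc g ∈ pcMonomial hΓ hc)
    (x : Complex (tildeGraph Γ) (fun p : PCIndex Γ => G p.1)) :
    tildeCellular hΓ hc ⟨toAut hΓ hc g, hg⟩ • x = g • x := by
  set θ := tildeCellular hΓ hc ⟨toAut hΓ hc g, hg⟩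
  have h1 : ∀ S : CliqueCoset (tildeGraph Γ) (fun p : PCIndex Γ => G p.1), θ • S = g • S := by
    intro S
    refine Subtype.ext ?_
    change tildePerm hΓ hc ⟨toAut hΓ hc g, hg⟩ '' S.1 = (fun x => g * x) '' S.1
    exact Set.image_congr' fun x => tildePerm_toAut hΓ hc g x hg
  apply Complex.ext
  ext S
  change x.weight (θ⁻¹ • S) = x.weight (g⁻¹ • S)
  rw [inv_smul_eq_iff.2 (show S = θ • (g⁻¹ • S) by rw [h1, smul_inv_smul])]

/-- With `s ∈ S` fixed, `h` is recovered from the point `h s` of the finite set `S` and the monomial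
element `(h s)⁻¹ * h * s`. -/
theorem finite_stabilizer [∀ v, Finite (G v)]
    (S : CliqueCoset (tildeGraph Γ) (fun p : PCIndex Γ => G p.1)) :
    {h | tildeCellular hΓ hc h • S = S}.Finite := by
  obtain ⟨s, hs⟩ := S.nonempty
  have h1 : Finite S.1 := S.finite
  have h2 : Finite (monomialAut Γ G) := finite_monomialAut
  have hmem : ∀ h, tildeCellular hΓ hc h • S = S → tildePerm hΓ hc h s ∈ S.1 := by
    intro h hh
    have : tildePerm hΓ hc h s ∈ (tildeCellular hΓ hc h • S).1 := ⟨s, hs, rfl⟩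
    rwa [hh] at this
  refine Set.finite_coe_iff.1 (Finite.of_injective (β := S.1 × monomialAut Γ G)
    (fun h => (⟨_, hmem h.1 h.2⟩, ⟨_, tildeAct_spec hΓ hc h.1 s⟩)) ?_)
  rintro ⟨h, hh⟩ ⟨k, hk⟩ hhk
  simp only [Prod.mk.injEq, Subtype.mk.injEq] at hhk
  obtain ⟨h3, h4⟩ := hhk
  rw [tildePerm_apply, tildePerm_apply] at h3
  rw [h3] at h4
  exact Subtype.ext (Subtype.ext (mul_left_cancel (mul_right_cancel h4)))

theorem mem_monomialAut_of_tildeCellular_eq_one {h : pcMonomial hΓ hc}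
    (hh : tildeCellular hΓ hc h = 1) : h.1 ∈ monomialAut Γ G := by
  have h1 := tildeAct_spec hΓ hc h 1
  rw [show tildeAct hΓ hc h 1 = 1 from DFunLike.congr_fun (congrArg Subtype.val hh) 1] at h1
  simpa using h1

/-- Such an `h` is monomial and acts on `G_Γ̃` by conjugation. The vertex `u` provides a component
`C` of `Γ ∖ st(v)`, and fixing the elements at `p_{v,C}` forces `h` to fix `G_v`. -/
theorem apply_eq_of_tildeCellular_eq_one {h : pcMonomial hΓ hc}
    (hh : tildeCellular hΓ hc h = 1) {v u : V} (hv : u ∉ star Γ v) (a : G v) :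
    h.1 (of Γ G v a) = of Γ G v a := by
  have hs := mem_monomialAut_of_tildeCellular_eq_one hΓ hc hh
  have ⟨τ, hτ⟩ := hs
  obtain ⟨p, rfl⟩ : ∃ p : PCIndex Γ, p.1 = v := ⟨PCIndex.ofMem hv, rfl⟩
  obtain ⟨b, hb⟩ := hτ.exists_apply_eq p.1 a
  have h1 := toAut_tildePerm hΓ hc (h := h) (g := 1) hs (by rw [map_one, one_mul]) (tof Γ G p a)
  rw [show tildePerm hΓ hc h (tof Γ G p a) = tof Γ G p a from
    DFunLike.congr_fun (congrArg Subtype.val hh) _, hτ.conj_toAut_tof hΓ hc hb] at h1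
  rw [hb]
  exact (of_eq_of_tof_eq (q := p.map τ) (toAut_injective hΓ hc h1)).symm

/-- Only a vertex adjacent to all others is left to check. It is unique, hence fixed by `τ`, and its
group has a single nontrivial element, which must be fixed too. -/
theorem tildeCellular_injective (hcen : ∀ u, (∀ w, w ≠ u → Γ.Adj u w) →
    (∀ a b : G u, a ≠ 1 → b ≠ 1 → a = b) ∧ ∀ u', (∀ w, w ≠ u' → Γ.Adj u' w) → u' = u) :
    Function.Injective (tildeCellular (Γ := Γ) hΓ hc) := by
  rw [injective_iff_map_eq_one]
  intro h hh
  refine Subtype.ext (mulAut_ext fun v a => ?_)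
  by_cases hv : ∃ u, u ∉ star Γ v
  · obtain ⟨u, hu⟩ := hv
    exact apply_eq_of_tildeCellular_eq_one hΓ hc hh hu a
  · have hv' : ∀ w, w ≠ v → Γ.Adj v w := by
      intro w hw
      by_contra hvw
      exact hv ⟨w, notMem_star_iff.2 ⟨hw.symm, hvw⟩⟩
    obtain ⟨τ, hτ⟩ := mem_monomialAut_of_tildeCellular_eq_one hΓ hc hh
    have hτv : τ v = v := by
      refine (hcen v hv').2 _ fun w hw => ?_
      obtain ⟨w, rfl⟩ := τ.surjective w
      exact τ.map_adj_iff.2 (hv' w fun h => hw (h ▸ rfl))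
    have h1 := hτ.exists_apply_eq v a
    rw [hτv] at h1
    obtain ⟨b, hb⟩ := h1
    by_cases ha : a = 1
    · rw [ha, map_one, map_one, map_one]
    · have hb' : b ≠ 1 := by
        rintro rfl
        rw [map_one, ← map_one h.1] at hb
        exact ha (of_injective v ((h.1.injective hb).trans (map_one _).symm))
      change h.1 _ = _
      rw [hb, (hcen v hv').1 a b ha hb']
      rfl

/-- Without separating intersections of links, the action of the graph product over `Γ̃` on its
complex extends to a geometric action of every group of automorphisms between the group of
partial conjugations and its extension by the monomial automorphisms. -/
theorem exists_geometric_action [∀ v, Finite (G v)] (B : Subgroup (MulAut (GraphProduct Γ G)))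
    (hr : ∀ g, toAut hΓ hc g ∈ B) (hB : B ≤ pcMonomial hΓ hc) :
    ∃ ρ : B →* (Complex (tildeGraph Γ) (fun p : PCIndex Γ => G p.1) ≃ᵢ
        Complex (tildeGraph Γ) (fun p : PCIndex Γ => G p.1)),
      (∀ g x, ρ ⟨toAut hΓ hc g, hr g⟩ x = g • x) ∧ IsGeometric ρ ∧
      ((∀ u, (∀ w, w ≠ u → Γ.Adj u w) →
        (∀ a b : G u, a ≠ 1 → b ≠ 1 → a = b) ∧ ∀ u', (∀ w, w ≠ u' → Γ.Adj u' w) → u' = u) →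
        Function.Injective ρ) := by
  let κ : B →* cellular (tildeGraph Γ) (fun p : PCIndex Γ => G p.1) :=
    (tildeCellular hΓ hc).comp (Subgroup.inclusion hB)
  have hρ : ∀ g x, cellularIsometry _ _ (κ ⟨toAut hΓ hc g, hr g⟩) x = g • x := fun g x =>
    tildeCellular_toAut_smul hΓ hc g _ x
  refine ⟨(cellularIsometry _ _).comp κ, hρ, ⟨fun x => ?_, ?_⟩, fun hcen => ?_⟩
  · exact Complex.exists_ball_finite κ (fun S => (finite_stabilizer hΓ hc S).preimage
      (Subgroup.inclusion_injective hB).injOn) x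
  · obtain ⟨K, hK, hK'⟩ :=
      Complex.exists_compact_cover (tildeGraph Γ) (fun p : PCIndex Γ => G p.1)
    refine ⟨K, hK, Set.eq_univ_of_forall fun x => ?_⟩
    obtain ⟨g, k, hk, rfl⟩ := hK' x
    exact Set.mem_iUnion.2 ⟨⟨toAut hΓ hc g, hr g⟩, k, hk, hρ g k⟩
  · exact cellularIsometry_injective.comp
      ((tildeCellular_injective hΓ hc hcen).comp (Subgroup.inclusion_injective hB))

end Action

/-- The modulus is a variable with an equation, so that it can be substituted and the claim decided
in `ZMod 2`. -/
theorem zmod_eq_of_ne_zero {m : ℕ} (hm : m = 2) (a b : ZMod m) (ha : a ≠ 0) (hb : b ≠ 0) :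
    a = b := by
  subst hm
  revert a b
  decide

end GrProd

end

theorem corollary4p2 {V : Type*} [Finite V] (Γ : SimpleGraph V) (n : V → ℕ)
    (hn : ∀ v, 2 ≤ n v) (hΓ : ¬ GrProd.HasSIL Γ) :
    -- `Σ_Γ` is finite, and the subgroup generated by it and `Aut^pc` is their semi-direct product
    Finite (GrProd.sigma Γ n) ∧
    GrProd.sigma Γ n ≤ Subgroup.normalizer (GrProd.autPC Γ n) ∧
    GrProd.autPC Γ n ⊓ GrProd.sigma Γ n = ⊥ ∧
    -- the identification of `Aut^pc` with the graph product over `Γ̃`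
    ∃ φ : GrProd.CycProd (GrProd.tildeGraph Γ) (GrProd.tildeOrder Γ n) ≃* GrProd.autPC Γ n,
      (∀ p : GrProd.PCIndex Γ,
        (φ (GrProd.gen (GrProd.tildeGraph Γ) (GrProd.tildeOrder Γ n) p) :
          MulAut (GrProd.CycProd Γ n)) = GrProd.piConj Γ n p) ∧
      -- the extended action
      ∃ ρ : (GrProd.autPC Γ n ⊔ GrProd.sigma Γ n : Subgroup (MulAut (GrProd.CycProd Γ n))) →*
          (GrProd.Complex (GrProd.tildeGraph Γ) (GrProd.Cyc (GrProd.tildeOrder Γ n)) ≃ᵢ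
            GrProd.Complex (GrProd.tildeGraph Γ) (GrProd.Cyc (GrProd.tildeOrder Γ n))),
        (∀ g x, ρ (Subgroup.inclusion le_sup_left (φ g)) x = g • x) ∧
        GrProd.IsGeometric ρ ∧
        ((∀ u, (∀ w, w ≠ u → Γ.Adj u w) →
            n u = 2 ∧ ∀ u', (∀ w, w ≠ u' → Γ.Adj u' w) → u' = u) →
          Function.Injective ρ) := by
  have hfin : ∀ v, Finite (GrProd.Cyc n v) := fun v =>
    have : NeZero (n v) := ⟨by have := hn v; omega⟩
    inferInstanceAs (Finite (ZMod (n v)))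
  have hnt : ∀ v, Nontrivial (GrProd.Cyc n v) := fun v =>
    have : Fact (1 < n v) := ⟨hn v⟩
    inferInstanceAs (Nontrivial (ZMod (n v)))
  have hr := GrProd.range_toAut_eq_autPC (n := n) hΓ
  have hinj := GrProd.toAut_injective hΓ (GrProd.cyc_commute (n := n))
  obtain ⟨ρ, hρ, hgeom, hfaith⟩ := GrProd.exists_geometric_action hΓ (GrProd.cyc_commute (n := n))
    (GrProd.autPC Γ n ⊔ GrProd.sigma Γ n)
    (fun g => (le_sup_left : GrProd.autPC Γ n ≤ _) (hr ▸ ⟨g, rfl⟩))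
    (sup_le_sup hr.ge GrProd.sigma_le_monomialAut)
  refine ⟨?_, ?_, ?_, (MonoidHom.ofInjective hinj).trans (MulEquiv.subgroupCongr hr), ?_,
    ρ, hρ, hgeom, ?_⟩
  · have : Finite (GrProd.monomialAut Γ (GrProd.Cyc n)) := GrProd.finite_monomialAut
    exact Finite.of_injective _ (Subgroup.inclusion_injective GrProd.sigma_le_monomialAut)
  · rw [← hr]
    exact GrProd.sigma_le_monomialAut.trans
      (GrProd.monomialAut_le_normalizer hΓ GrProd.cyc_commute)
  · rw [eq_bot_iff, ← hr]
    rintro _ ⟨⟨g, rfl⟩, hg⟩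
    exact GrProd.eq_one_of_toAut_mem_monomialAut hΓ GrProd.cyc_commute
      (GrProd.sigma_le_monomialAut hg)
  -- The graph product labelled by `tildeOrder` is definitionally `TildeProd Γ (Cyc n)`, and its
  -- generators are the values of `tof` at `1 : ZMod (n p.1)`.
  · exact fun p => GrProd.toAut_tof hΓ GrProd.cyc_commute p _
  · exact fun h => hfaith fun u hu =>
      ⟨fun a b ha hb => GrProd.zmod_eq_of_ne_zero (h u hu).1 a b ha hb, (h u hu).2⟩
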